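/- Let $V$ be the set-theoretic universe, let $\kappa$ be an uncountable cardinal and let $\mu$ be a measure on $\kappa$, i.e. a nonprincipal $\kappa$-complete ultrafilter on $\kappa$. Let $\langle M_\beta, j_{\xi,\beta} : \xi\le\beta\in\mathrm{Ord}\rangle$ be the iteration of $V$ by $\mu$: $M_0=V$; $M_{\beta+1}$ is the transitive collapse of the ultrapower of $M_\beta$ by $j_{0,\beta}(\mu)$, formed with the functions with domain $j_{0,\beta}(\kappa)$ that belong to $M_\beta$, and $j_{\beta,\beta+1}$ is the canonical embedding; and for limit $\lambda$, $M_\lambda$ is the transitive collapse of the direct limit of $\langle M_\beta, j_{\xi,\beta} : \xi\le\beta<\lambda\rangle$, with the canonical embeddings $j_{\xi,\lambda}$. Then for every ordinal $\beta<\kappa$ and every ordinal $\alpha$, $$M_\beta\models \mathrm{cf}(\alpha)=\kappa\quad\Longleftrightarrow\quad V\models \mathrm{cf}(\alpha)=\kappa .$$ -/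

import Mathlib

universe u

namespace IterUlt

/-- The von Neumann ordinal `κ` (the initial ordinal of the cardinal `κ`) as a set. -/
noncomputable def ordSet (κ : Cardinal.{u}) : ZFSet.{u} := κ.ord.toZFSet

/-- `μ` is a measure on the uncountable cardinal `κ`: a nonprincipal `κ`-complete ultrafilter
on `κ`. (Normality is not required.) -/
structure IsMeasure (κ : Cardinal.{u}) (μ : ZFSet.{u}) : Prop where
  uncountable : Cardinal.aleph0 < κ
  subset_of_mem : ∀ X ∈ μ, X ⊆ ordSet κ
  empty_notMem : ∅ ∉ μ
  upward : ∀ X ∈ μ, ∀ Y : ZFSet.{u}, X ⊆ Y → Y ⊆ ordSet κ → Y ∈ μ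
  ultra : ∀ X : ZFSet.{u}, X ⊆ ordSet κ → X ∈ μ ∨ ordSet κ \ X ∈ μ
  nonprincipal : ∀ ξ ∈ ordSet κ, ({ξ} : ZFSet.{u}) ∉ μ
  complete : ∀ F : ZFSet.{u}, F ⊆ μ → F.Nonempty → F.card < κ → (ZFSet.sInter F) ∈ μ

/-! ### Transitive collapse -/

open Classical in
/-- The set whose elements are exactly the elements of `s`, if `s` is small (i.e. a set rather
than a proper class); `∅` otherwise. -/
noncomputable def ofSmall (s : Set ZFSet.{u}) : ZFSet.{u} :=
  if h : Small.{u} s then ZFSet.coeEquiv.symm ⟨s, h⟩ else ∅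

open Classical in
/-- The Mostowski collapse `π x = {π y | y E x}` of a well-founded relation `E`
(constantly `∅` if `E` is ill-founded). -/
noncomputable def collapse {T : Type (u + 1)} (E : T → T → Prop) : T → ZFSet.{u} :=
  if h : WellFounded E then
    h.fix fun x π => ofSmall (Set.range fun y : {y : T // E y x} => π y.1 y.2)
  else fun _ => ∅

/-- A structure given by representatives in `T`, with equality `r` and membership `e`: pass to the
quotient modulo `r`, with the induced membership relation, and send each representative
to the Mostowski collapse of its class. -/
noncomputable def quotCollapse {T : Type (u + 1)} (r e : T → T → Prop) (x : T) : ZFSet.{u} :=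
  collapse (fun a b : Quot r => ∃ y z : T, a = Quot.mk r y ∧ b = Quot.mk r z ∧ e y z)
    (Quot.mk r x)

/-! ### The ultrapower of a transitive class `M` by `U ∈ M`, an ultrafilter on `d ∈ M` in `M` -/

/-- The functions with domain `d` which are elements of `M`. -/
def Fn (M : Set ZFSet.{u}) (d : ZFSet.{u}) : Type (u + 1) :=
  {f : ZFSet.{u} // f ∈ M ∧ ∃ y : ZFSet.{u}, ZFSet.IsFunc d y f}

/-- `f(ξ) = g(ξ)` for `U`-almost all `ξ ∈ d`. -/
def aeEq {M : Set ZFSet.{u}} {d : ZFSet.{u}} (U : ZFSet.{u}) (f g : Fn M d) : Prop :=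
  ZFSet.sep (fun ξ => ∃ v, ZFSet.pair ξ v ∈ f.1 ∧ ZFSet.pair ξ v ∈ g.1) d ∈ U

/-- `f(ξ) ∈ g(ξ)` for `U`-almost all `ξ ∈ d`. -/
def aeMem {M : Set ZFSet.{u}} {d : ZFSet.{u}} (U : ZFSet.{u}) (f g : Fn M d) : Prop :=
  ZFSet.sep (fun ξ => ∃ v w, ZFSet.pair ξ v ∈ f.1 ∧ ZFSet.pair ξ w ∈ g.1 ∧ v ∈ w) d ∈ U

/-- The element of the (transitive collapse of the) ultrapower represented by `f`. -/
noncomputable def ultClass {M : Set ZFSet.{u}} {d : ZFSet.{u}} (U : ZFSet.{u}) (f : Fn M d) :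
    ZFSet.{u} :=
  quotCollapse (aeEq U) (aeMem U) f

/-- The (transitive collapse of the) ultrapower of `M` by `U`. -/
def Ult (M : Set ZFSet.{u}) (d U : ZFSet.{u}) : Set ZFSet.{u} :=
  Set.range fun f : Fn M d => ultClass U f

open Classical in
/-- The canonical embedding of `M` into its ultrapower: `x` is sent to the class of the constant
function on `d` with value `x`. (The values for `x ∉ M` are irrelevant.) -/
noncomputable def ultEmb (M : Set ZFSet.{u}) (d U x : ZFSet.{u}) : ZFSet.{u} :=
  if h : ZFSet.prod d {x} ∈ M ∧ ∃ y : ZFSet.{u}, ZFSet.IsFunc d y (ZFSet.prod d {x}) then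
    ultClass U (⟨ZFSet.prod d {x}, h⟩ : Fn M d)
  else ∅

/-! ### The iteration -/

/-- A stage `η` of the iteration: the class `M_η`, and the embeddings
`emb ξ = j_{ξ,η} : M_ξ → M_η` for `ξ ≤ η`.
(The values of `emb ξ` outside `M_ξ`, and of `emb ξ` for `ξ > η`, are irrelevant.) -/
structure Stage where
  carrier : Set ZFSet.{u}
  emb : Ordinal.{u} → ZFSet.{u} → ZFSet.{u}

open Classical in
/-- The stage after stage `η`: `M_{η+1}` is the ultrapower of `M_η` by `j_{0,η}(μ)`, formed with
the functions in `M_η` with domain `j_{0,η}(κ)`. -/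
noncomputable def succStage (κ μ : ZFSet.{u}) (η : Ordinal.{u}) (S : Stage.{u}) : Stage.{u} where
  carrier := Ult S.carrier (S.emb 0 κ) (S.emb 0 μ)
  emb ξ x := if ξ ≤ η then ultEmb S.carrier (S.emb 0 κ) (S.emb 0 μ) (S.emb ξ x) else x

/-- Representatives for the direct limit of the stages below `l`: pairs `(ξ, x)` with `ξ < l` and
`x ∈ M_ξ`. -/
def Thread (l : Ordinal.{u}) (S : ∀ ξ < l, Stage.{u}) : Type (u + 1) :=
  {p : Ordinal.{u} × ZFSet.{u} // ∃ h : p.1 < l, p.2 ∈ (S p.1 h).carrier}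

/-- `(ξ, x)` and `(η, y)` represent the same element of the direct limit:
`j_{ξ,ζ}(x) = j_{η,ζ}(y)` for some `ζ < l` above `ξ` and `η`. -/
def threadEq {l : Ordinal.{u}} {S : ∀ ξ < l, Stage.{u}} (p q : Thread l S) : Prop :=
  ∃ (ζ : Ordinal.{u}) (h : ζ < l), p.1.1 ≤ ζ ∧ q.1.1 ≤ ζ ∧
    (S ζ h).emb p.1.1 p.1.2 = (S ζ h).emb q.1.1 q.1.2

/-- `(ξ, x)` represents a member of `(η, y)` in the direct limit:
`j_{ξ,ζ}(x) ∈ j_{η,ζ}(y)` for some `ζ < l` above `ξ` and `η`. -/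
def threadMem {l : Ordinal.{u}} {S : ∀ ξ < l, Stage.{u}} (p q : Thread l S) : Prop :=
  ∃ (ζ : Ordinal.{u}) (h : ζ < l), p.1.1 ≤ ζ ∧ q.1.1 ≤ ζ ∧
    (S ζ h).emb p.1.1 p.1.2 ∈ (S ζ h).emb q.1.1 q.1.2

open Classical in
/-- The stage at a limit ordinal `l`: the (transitive collapse of the) direct limit of the
previous stages, with the canonical embeddings into it. -/
noncomputable def limitStage (l : Ordinal.{u}) (S : ∀ ξ < l, Stage.{u}) : Stage.{u} where
  carrier := Set.range fun p : Thread l S => quotCollapse threadEq threadMem p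
  emb ξ x :=
    if ξ < l then
      if h : ∃ h : ξ < l, x ∈ (S ξ h).carrier then
        quotCollapse threadEq threadMem (⟨(ξ, x), h⟩ : Thread l S)
      else ∅
    else x

/-- The `η`-th stage of the iteration of the universe `V = M_0` by `μ`. -/
noncomputable def stage (κ μ : ZFSet.{u}) (η : Ordinal.{u}) : Stage.{u} :=
  Ordinal.limitRecOn η
    { carrier := Set.univ, emb := fun _ x => x }
    (fun η S => succStage κ μ η S)
    (fun l _ S => limitStage l S)

/-- The `β`-th iterate `M_β` of the universe by the measure `μ` on `κ`. -/
noncomputable def Iterate (κ : Cardinal.{u}) (μ : ZFSet.{u}) (β : Ordinal.{u}) : Set ZFSet.{u} :=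
  (stage (ordSet κ) μ β).carrier

/-! ### Cofinality in a transitive class -/

/-- `f` is a function from the ordinal `δ` to the ordinal `α` with range cofinal in `α`. -/
def IsCofinalMap (f δ α : ZFSet.{u}) : Prop :=
  ZFSet.IsFunc δ α f ∧ ∀ x ∈ α, ∃ y ∈ δ, ∃ z ∈ α, ZFSet.pair y z ∈ f ∧ (x = z ∨ x ∈ z)

/-- `M ⊨ cf(α) = δ`, for a transitive class `M` and ordinals `α`, `δ`: both belong to `M`, and `δ`
is the least ordinal from which there is, in `M`, a cofinal map to `α`. -/
def SatCofEq (M : Set ZFSet.{u}) (α δ : ZFSet.{u}) : Prop :=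
  α ∈ M ∧ δ ∈ M ∧ (∃ f ∈ M, IsCofinalMap f δ α) ∧ ∀ γ ∈ δ, ¬ ∃ f ∈ M, IsCofinalMap f γ α

end IterUlt

/-!
The iterates are described by functions of finitely many coordinates. Let `U` be the ultrafilter on
`κ` given by `μ`. On sequences `s` of points of `κ` indexed by ordinals, `prodFilter U β` is the
`β`-fold iterated product of `U`: a set is large if it contains every sequence that follows some
strategy, where a strategy chooses for each coordinate below `β`, given the earlier coordinates, a
large set of admissible values. This filter is proper and `κ`-complete
(`LtComplete.prodFilter`), its last coordinate can be quantified separately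
(`eventually_prodFilter_add_one`), and it decides every predicate that depends on finitely many
coordinates (`eventually_or_eventually_not`).

Set-valued functions of finitely many coordinates below `β`, with membership almost everywhere, form
a well-founded structure by countable completeness, and `rho U β` is its Mostowski collapse. By
induction on `β`, its range is `M_β`, and the embedding `M_ξ → M_β` sends the element represented by
`f` at `ξ` to the one represented by the same `f` at `β` (`IsMeasure.isRepresented_stage`). At
successors a function in `M_β` with domain `j_{0,β}(κ)` is represented by a family of functions
with domain `κ`, which uncurries to a function of one more coordinate; at limits a finite set of
coordinates is bounded below the limit.

The iterate contains all ordinals, is closed under restriction of functions, and its embeddings fix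
the ordinals below `κ`. If `cf(α) = κ`, each element of `α` is represented by a function of a finite
set of coordinates below `β < κ`. As there are fewer than `κ` such sets, one of them serves for
cofinally many elements (`IsMeasure.exists_common_support`); an enumeration of these in length `κ`
belongs to `M_β`, because the sequence of representing functions represents a function in `M_β` of
which it is the restriction to `κ` (`IsMeasure.seq_mem_itr`). No shorter sequence in `M_β` is
cofinal, since none in `V` is. Conversely, if `M_β` has a cofinal sequence of length `κ` in `α`,
then `cf(α) ≤ κ`; if `cf(α) < κ`, then by regularity of `κ` a proper initial segment of that
sequence is already cofinal, and it belongs to `M_β` (`IsMeasure.le_cof_of_satCofEq`).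
-/

namespace IterUlt

open Filter

/-! ### Iterated products of an ultrafilter -/

section Product

universe v

/-- `l` is closed under intersections of fewer than `κ` sets. The index types range over
`Type u` only, so that `l` may live in a higher universe than `κ`. -/
def LtComplete {T : Type v} (l : Filter T) (κ : Cardinal.{u}) : Prop :=
  ∀ (ι : Type u) (P : ι → T → Prop), Cardinal.mk ι < κ →
    (∀ i, ∀ᶠ x in l, P i x) → ∀ᶠ x in l, ∀ i, P i x

variable {K : Type v} {U : Ultrafilter K}

/-- A strategy prescribes, for each coordinate `i` of a sequence and each choice of the earlier
coordinates, a large set from which coordinate `i` is to be taken. -/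
structure IsStrategy (U : Ultrafilter K) (σ : Ordinal.{u} → (Ordinal.{u} → K) → Set K) : Prop where
  mem : ∀ i s, σ i s ∈ U
  congr : ∀ i s t, (∀ j < i, s j = t j) → σ i s = σ i t

theorem IsStrategy.univ : IsStrategy U fun (_ : Ordinal.{u}) _ => Set.univ :=
  ⟨fun _ _ => Filter.univ_mem, fun _ _ _ _ => rfl⟩

/-- Every sequence can be redefined from coordinate `γ` on so as to follow a given strategy
there. -/
theorem IsStrategy.exists_extension {σ : Ordinal.{u} → (Ordinal.{u} → K) → Set K}
    (hσ : IsStrategy U σ) (γ : Ordinal.{u}) (s : Ordinal.{u} → K) :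
    ∃ t : Ordinal.{u} → K, (∀ i < γ, t i = s i) ∧ ∀ i, γ ≤ i → t i ∈ σ i t := by
  classical
  have hne : ∀ i r, (σ i r).Nonempty := fun i r => U.nonempty_of_mem (hσ.mem i r)
  let step : ∀ i : Ordinal.{u}, (∀ j, j < i → K) → K := fun i r =>
    if i < γ then s i else (hne i fun j => if h : j < i then r j h else s j).choose
  let t : Ordinal.{u} → K := Ordinal.lt_wf.fix step
  have ht : ∀ i, t i = step i fun j _ => t j := fun i => Ordinal.lt_wf.fix_eq step i
  refine ⟨t, fun i hi => ?_, fun i hi => ?_⟩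
  · rw [ht]
    exact if_pos hi
  · have h1 : t i = (hne i fun j => if j < i then t j else s j).choose := by
      rw [ht]
      simp only [step, if_neg hi.not_gt, dite_eq_ite]
    rw [h1, hσ.congr i t fun j => if j < i then t j else s j]
    · exact (hne i fun j => if j < i then t j else s j).choose_spec
    · intro j hj
      rw [if_pos hj]

/-- The `β`-fold iterated product of `U`, as a filter on sequences: a set is large if it contains
all sequences that follow some strategy at the coordinates below `β`. Sequences are indexed by all
ordinals, so that functions of finitely many coordinates make sense at every stage; the coordinates
from `β` on are unconstrained. -/
def prodFilter (U : Ultrafilter K) (β : Ordinal.{u}) : Filter (Ordinal.{u} → K) where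
  sets := {A | ∃ σ, IsStrategy U σ ∧ ∀ s, (∀ i < β, s i ∈ σ i s) → s ∈ A}
  univ_sets := ⟨_, .univ, fun _ _ => trivial⟩
  sets_of_superset := fun ⟨σ, hσ, h⟩ hAB => ⟨σ, hσ, fun s hs => hAB (h s hs)⟩
  inter_sets := fun ⟨σ, hσ, h⟩ ⟨τ, hτ, h'⟩ =>
    ⟨fun i s => σ i s ∩ τ i s,
      ⟨fun i s => Filter.inter_mem (hσ.mem i s) (hτ.mem i s),
        fun i s t hst => by rw [hσ.congr i s t hst, hτ.congr i s t hst]⟩,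
      fun s hs => ⟨h s fun i hi => (hs i hi).1, h' s fun i hi => (hs i hi).2⟩⟩

instance prodFilter_neBot (β : Ordinal.{u}) : (prodFilter U β).NeBot := by
  refine ⟨fun h => ?_⟩
  obtain ⟨σ, hσ, h⟩ := (Filter.empty_mem_iff_bot.2 h : _)
  obtain ⟨t, -, ht⟩ := hσ.exists_extension 0 fun _ => U.nonempty_of_mem Filter.univ_mem |>.some
  exact h t fun i _ => ht i zero_le

theorem eventually_prodFilter_zero {P : (Ordinal.{u} → K) → Prop} :
    (∀ᶠ s in prodFilter U 0, P s) ↔ ∀ s, P s :=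
  ⟨fun ⟨_, _, h⟩ s => h s fun _ hi => absurd hi not_lt_zero,
    fun h => Filter.Eventually.of_forall h⟩

theorem LtComplete.prodFilter {κ : Cardinal.{u}} (hU : LtComplete (U : Filter K) κ)
    (β : Ordinal.{u}) : LtComplete (prodFilter U β) κ := by
  intro ι P hι h
  choose σ hσ hP using h
  refine ⟨fun i s => {x | ∀ k, x ∈ σ k i s}, ⟨fun i s => hU ι _ hι fun k => (hσ k).mem i s,
    fun i s t hst => ?_⟩, fun s hs k => hP k s fun i hi => hs i hi k⟩
  simp only [fun k => (hσ k).congr i s t hst]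

/-- Fubini: the last coordinate of a `(β + 1)`-fold product can be quantified separately. -/
theorem eventually_prodFilter_add_one {β : Ordinal.{u}} {P : (Ordinal.{u} → K) → Prop}
    (hP : DependsOn P (Set.Iio (β + 1))) :
    (∀ᶠ s in prodFilter U (β + 1), P s) ↔
      ∀ᶠ s in prodFilter U β, ∀ᶠ x in (U : Filter K), P (Function.update s β x) := by
  classical
  constructor
  · rintro ⟨σ, hσ, h⟩
    refine ⟨σ, hσ, fun s hs => Filter.mem_of_superset (hσ.mem β s) fun x hx => ?_⟩
    refine h _ fun i hi => ?_
    have hle : i ≤ β := Order.lt_add_one_iff.1 hi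
    rw [hσ.congr i (Function.update s β x) s fun j hj =>
      Function.update_of_ne (hj.trans_le hle).ne _ _]
    rcases hle.eq_or_lt with rfl | hlt
    · rwa [Function.update_self]
    · rw [Function.update_of_ne hlt.ne]
      exact hs i hlt
  · rintro ⟨σ, hσ, h⟩
    let A : (Ordinal.{u} → K) → Set K := fun s => {x | P (Function.update s β x)}
    have hA : ∀ s t : Ordinal.{u} → K, (∀ j < β, s j = t j) → A s = A t := by
      intro s t hst
      ext x
      refine iff_of_eq (hP fun i hi => ?_)
      rcases (Order.lt_add_one_iff.1 (Set.mem_Iio.1 hi)).eq_or_lt with rfl | hlt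
      · simp
      · rw [Function.update_of_ne hlt.ne, Function.update_of_ne hlt.ne]
        exact hst i hlt
    refine ⟨fun i s => if i = β then (if A s ∈ U then A s else Set.univ) else σ i s,
      ⟨fun i s => ?_, fun i s t hst => ?_⟩, fun s hs => ?_⟩
    · split_ifs with h1 h2
      · exact h2
      · exact Filter.univ_mem
      · exact hσ.mem i s
    · by_cases h1 : i = β
      · subst h1
        rw [if_pos rfl, if_pos rfl, hA s t hst]
      · rw [if_neg h1, if_neg h1]
        exact hσ.congr i s t hst
    · have h1 : A s ∈ U := h s fun i hi => by
        have := hs i (hi.trans (lt_add_one β))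
        beta_reduce at this
        rwa [if_neg hi.ne] at this
      have h2 := hs β (lt_add_one β)
      beta_reduce at h2
      rw [if_pos rfl, if_pos h1] at h2
      have h3 : P (Function.update s β (s β)) := h2
      rw [Function.update_eq_self] at h3
      exact h3

/-- The product filters are coherent, so representing functions can be read at any later stage. -/
theorem eventually_prodFilter_of_le {γ β : Ordinal.{u}} (hγ : γ ≤ β)
    {P : (Ordinal.{u} → K) → Prop} (hP : DependsOn P (Set.Iio γ)) :
    (∀ᶠ s in prodFilter U β, P s) ↔ ∀ᶠ s in prodFilter U γ, P s := by
  constructor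
  · rintro ⟨σ, hσ, h⟩
    refine ⟨σ, hσ, fun s hs => ?_⟩
    obtain ⟨t, h1, h2⟩ := hσ.exists_extension γ s
    have h3 : P t = P s := hP h1
    change P s
    rw [← h3]
    refine h t fun i _ => ?_
    rcases lt_or_ge i γ with hi | hi
    · rw [hσ.congr i t s fun j hj => h1 j (hj.trans hi), h1 i hi]
      exact hs i hi
    · exact h2 i hi
  · rintro ⟨σ, hσ, h⟩
    exact ⟨σ, hσ, fun s hs => h s fun i hi => hs i (hi.trans_le hγ)⟩

/-- The product filter decides every predicate depending on finitely many coordinates. -/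
theorem eventually_or_eventually_not (a : Finset Ordinal.{u}) :
    ∀ {β : Ordinal.{u}} {P : (Ordinal.{u} → K) → Prop}, (∀ i ∈ a, i < β) → DependsOn P (a : Set _) →
      (∀ᶠ s in prodFilter U β, P s) ∨ ∀ᶠ s in prodFilter U β, ¬ P s := by
  classical
  induction a using Finset.induction_on_max with
  | empty =>
    intro β P _ hP
    by_cases h : ∃ s, P s
    · obtain ⟨s, hs⟩ := h
      refine Or.inl (Filter.Eventually.of_forall fun t => ?_)
      have : P s = P t := hP (by simp)
      rwa [← this]
    · exact Or.inr (Filter.Eventually.of_forall fun t ht => h ⟨t, ht⟩)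
  | insert i a hi ih =>
    intro β P ha hP
    have hiβ : i + 1 ≤ β := Order.add_one_le_of_lt (ha i (Finset.mem_insert_self _ _))
    have hP1 : DependsOn P (Set.Iio (i + 1)) := hP.mono fun j hj => by
      rcases Finset.mem_insert.1 hj with rfl | hj
      · exact lt_add_one j
      · exact (hi j hj).trans (lt_add_one i)
    have hN1 : DependsOn (fun s => ¬ P s) (Set.Iio (i + 1)) := fun s t hst =>
      congrArg Not (hP1 hst)
    rw [eventually_prodFilter_of_le hiβ hP1, eventually_prodFilter_of_le hiβ hN1,
      eventually_prodFilter_add_one hP1, eventually_prodFilter_add_one hN1]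
    have hQ : DependsOn (fun s => ∀ᶠ x in (U : Filter K), P (Function.update s i x))
        (a : Set Ordinal.{u}) := fun s t hst => by
      have : ∀ x, P (Function.update s i x) = P (Function.update t i x) := fun x =>
        hP fun j hj => by
          rcases Finset.mem_insert.1 hj with rfl | hj
          · simp
          · rw [Function.update_of_ne (hi j hj).ne, Function.update_of_ne (hi j hj).ne]
            exact hst j hj
      simp only [this]
    refine (ih hi hQ).imp_right fun h => h.mono fun s hs => ?_
    exact Ultrafilter.eventually_not.2 hs

end Product

/-! ### The ultrafilter of a measure -/

section Measure

variable {κ : Cardinal.{u}} {μ : ZFSet.{u}}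

/-- The points of `κ`, i.e. the ordinals below `κ` in the sense of `ZFSet`. -/
abbrev Pt (κ : Cardinal.{u}) : Type (u + 1) := {x : ZFSet.{u} // x ∈ ordSet κ}

/-- The subset of `κ` given by a predicate on the points of `κ`. -/
noncomputable def ptSep (P : Pt κ → Prop) : ZFSet.{u} :=
  (ordSet κ).sep fun x => ∀ h : x ∈ ordSet κ, P ⟨x, h⟩

theorem mem_ptSep {P : Pt κ → Prop} {x : ZFSet.{u}} :
    x ∈ ptSep P ↔ ∃ h : x ∈ ordSet κ, P ⟨x, h⟩ := by
  rw [ptSep, ZFSet.mem_sep]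
  exact ⟨fun h => ⟨h.1, h.2 h.1⟩, fun ⟨h, h'⟩ => ⟨h, fun _ => h'⟩⟩

theorem ptSep_subset (P : Pt κ → Prop) : ptSep P ⊆ ordSet κ := ZFSet.sep_subset

theorem IsMeasure.ordSet_mem (hμ : IsMeasure κ μ) : ordSet κ ∈ μ := by
  rcases hμ.ultra ∅ (ZFSet.empty_subset _) with h | h
  · exact absurd h hμ.empty_notMem
  · convert h
    ext x
    simp

theorem IsMeasure.ptSep_mono (hμ : IsMeasure κ μ) {P Q : Pt κ → Prop}
    (h : ptSep P ∈ μ) (hPQ : ∀ x, P x → Q x) : ptSep Q ∈ μ :=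
  hμ.upward _ h _
    (fun _ hx => mem_ptSep.2 ((mem_ptSep.1 hx).imp fun _ => hPQ _)) (ptSep_subset Q)

theorem IsMeasure.ptSep_forall_mem (hμ : IsMeasure κ μ) (ι : Type u) (P : ι → Pt κ → Prop)
    (hι : Cardinal.mk ι < κ) (h : ∀ i, ptSep (P i) ∈ μ) : (ptSep fun x => ∀ i, P i x) ∈ μ := by
  rcases isEmpty_or_nonempty ι with hE | ⟨⟨i₀⟩⟩
  · convert hμ.ordSet_mem
    ext x
    simp [mem_ptSep]
  · have hne : (ZFSet.range fun i => ptSep (P i)).Nonempty := ⟨_, ZFSet.mem_range.2 ⟨i₀, rfl⟩⟩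
    have hcard := ZFSet.lift_card_range_le (f := fun i : ι => ptSep (P i))
    rw [Cardinal.lift_id, Cardinal.lift_id] at hcard
    have := hμ.complete (ZFSet.range fun i => ptSep (P i))
      (fun X hX => by
        obtain ⟨i, rfl⟩ := ZFSet.mem_range.1 hX
        exact h i) hne (hcard.trans_lt hι)
    convert this
    ext x
    rw [ZFSet.mem_sInter hne, mem_ptSep]
    constructor
    · rintro ⟨h1, h2⟩ z hz
      obtain ⟨i, rfl⟩ := ZFSet.mem_range.1 hz
      exact mem_ptSep.2 ⟨h1, h2 i⟩
    · intro h1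
      have h2 : ∀ i, x ∈ ptSep (P i) := fun i => h1 _ (ZFSet.mem_range.2 ⟨i, rfl⟩)
      exact ⟨(mem_ptSep.1 (h2 i₀)).1, fun i => (mem_ptSep.1 (h2 i)).2⟩

theorem IsMeasure.ptSep_and_mem (hμ : IsMeasure κ μ) {P Q : Pt κ → Prop}
    (hP : ptSep P ∈ μ) (hQ : ptSep Q ∈ μ) : (ptSep fun x => P x ∧ Q x) ∈ μ := by
  refine hμ.ptSep_mono (hμ.ptSep_forall_mem (ULift.{u} Bool)
    (fun i x => cond i.down (P x) (Q x))
    ((Cardinal.lt_aleph0_of_finite _).trans hμ.uncountable) ?_) fun x h => ⟨h ⟨true⟩, h ⟨false⟩⟩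
  rintro ⟨_ | _⟩
  · exact hQ
  · exact hP

theorem IsMeasure.ptSep_not_mem_iff (hμ : IsMeasure κ μ) (P : Pt κ → Prop) :
    (ptSep fun x => ¬ P x) ∉ μ ↔ ptSep P ∈ μ := by
  have hd : (ptSep fun x => ¬ P x) = ordSet κ \ ptSep P := by
    ext x
    simp only [mem_ptSep, ZFSet.mem_sdiff, not_exists]
    exact ⟨fun ⟨h1, h2⟩ => ⟨h1, fun _ => h2⟩, fun ⟨h1, h2⟩ => ⟨h1, h2 h1⟩⟩
  refine ⟨fun h => (hμ.ultra _ (ptSep_subset P)).resolve_right (hd ▸ h), fun h h' => ?_⟩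
  refine hμ.empty_notMem ?_
  convert hμ.ptSep_and_mem h h'
  ext x
  simp [mem_ptSep]

/-- The measure `μ` as an ultrafilter on the type of points of `κ`. -/
def IsMeasure.ultrafilter (hμ : IsMeasure κ μ) : Ultrafilter (Pt κ) :=
  Ultrafilter.ofComplNotMemIff
    { sets := {A | ptSep (· ∈ A) ∈ μ}
      univ_sets := by
        have h : (ptSep fun x : Pt κ => x ∈ Set.univ) = ordSet κ := by
          ext x
          simp [mem_ptSep]
        exact (h ▸ hμ.ordSet_mem : (ptSep fun x : Pt κ => x ∈ Set.univ) ∈ μ)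
      sets_of_superset := fun {A B} (hA : ptSep (· ∈ A) ∈ μ) hAB => hμ.ptSep_mono hA hAB
      inter_sets := fun hA hB => hμ.ptSep_and_mem hA hB }
    (fun A => hμ.ptSep_not_mem_iff (· ∈ A))

theorem IsMeasure.eventually_iff_ptSep (hμ : IsMeasure κ μ) {P : Pt κ → Prop} :
    (∀ᶠ x in (hμ.ultrafilter : Filter (Pt κ)), P x) ↔ ptSep P ∈ μ :=
  Iff.rfl

theorem IsMeasure.eventually_iff (hμ : IsMeasure κ μ) {P : ZFSet.{u} → Prop} :
    (∀ᶠ x : Pt κ in (hμ.ultrafilter : Filter (Pt κ)), P x.1) ↔ (ordSet κ).sep P ∈ μ := by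
  rw [hμ.eventually_iff_ptSep]
  convert Iff.rfl using 2
  ext x
  simp [mem_ptSep]

theorem IsMeasure.ltComplete (hμ : IsMeasure κ μ) :
    LtComplete (hμ.ultrafilter : Filter (Pt κ)) κ :=
  fun ι P hι h => hμ.ptSep_forall_mem ι P hι h

theorem IsMeasure.eventually_ne (hμ : IsMeasure κ μ) (y : Pt κ) :
    ∀ᶠ x in (hμ.ultrafilter : Filter (Pt κ)), x ≠ y := by
  refine Ultrafilter.eventually_not.2 fun h => hμ.nonprincipal y.1 y.2 ?_
  have h' := hμ.eventually_iff (P := fun x => x = y.1) |>.1 (h.mono fun x hx => congrArg _ hx)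
  convert h'
  ext x
  simp only [ZFSet.mem_singleton, ZFSet.mem_sep]
  exact ⟨fun h => ⟨h ▸ y.2, h⟩, fun h => h.2⟩

/-- A measure concentrates on no bounded subset, so `κ` is not a union of fewer than `κ` bounded
subsets. -/
theorem IsMeasure.isRegular (hμ : IsMeasure κ μ) : κ.IsRegular := by
  refine ⟨hμ.uncountable.le, ?_⟩
  by_contra! hlt
  obtain ⟨C, hC, hCcard⟩ := Order.exists_cof_eq κ.ord.ToType
  rw [Ordinal.cof_toType] at hCcard
  let p : κ.ord.ToType → Pt κ := fun j =>
    ⟨(Ordinal.ToType.mk.symm j).1.toZFSet,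
      Ordinal.toZFSet_mem_toZFSet_iff.2 (Ordinal.ToType.mk.symm j).2⟩
  have hbd : ∀ i : C, ∀ᶠ x in (hμ.ultrafilter : Filter (Pt κ)),
      x ≠ p i.1 ∧ ∀ j : Set.Iio i.1, x ≠ p j.1 := fun i =>
    (hμ.eventually_ne _).and
      (hμ.ltComplete _ _ (by simpa using Cardinal.mk_Iio_lt i.1 (by simp)) fun j =>
        hμ.eventually_ne _)
  obtain ⟨x, hx⟩ := (hμ.ltComplete C _ (hCcard.trans_lt hlt) hbd).exists
  obtain ⟨o, ho, hox⟩ := Ordinal.mem_toZFSet_iff.1 x.2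
  have hpx : x = p (Ordinal.ToType.mk ⟨o, ho⟩) := Subtype.ext (by simp [p, hox])
  obtain ⟨i, hi, hle⟩ := hC (Ordinal.ToType.mk ⟨o, ho⟩)
  rcases hle.lt_or_eq with hlt | heq
  · exact (hx ⟨i, hi⟩).2 ⟨_, hlt⟩ hpx
  · exact (hx ⟨i, hi⟩).1 (heq ▸ hpx)

end Measure

/-! ### Functions of finitely many coordinates -/

section FinDep

universe v w

variable {K : Type v} {T T' T'' : Type w} {β : Ordinal.{u}}

/-- `f` depends only on finitely many coordinates, all of them below `β`. -/
def FinDep (β : Ordinal.{u}) (f : (Ordinal.{u} → K) → T) : Prop :=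
  ∃ a : Finset Ordinal.{u}, (∀ i ∈ a, i < β) ∧ DependsOn f (a : Set Ordinal.{u})

theorem FinDep.const (c : T) : FinDep β fun _ : Ordinal.{u} → K => c :=
  ⟨∅, by simp, fun _ _ _ => rfl⟩

theorem FinDep.eval {i : Ordinal.{u}} (hi : i < β) : FinDep β fun s : Ordinal.{u} → K => s i :=
  ⟨{i}, by simpa using hi, fun _ _ h => h i (by simp)⟩

theorem FinDep.comp {X : Type*} {f : (Ordinal.{u} → K) → T} (hf : FinDep β f) (F : T → X) :
    FinDep β fun s => F (f s) :=
  let ⟨a, ha, hfa⟩ := hf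
  ⟨a, ha, fun _ _ h => congrArg F (hfa h)⟩

theorem FinDep.comp₂ {X Y Z : Type*} {f : (Ordinal.{u} → K) → X} {g : (Ordinal.{u} → K) → Y}
    (hf : FinDep β f) (hg : FinDep β g) (F : X → Y → Z) : FinDep β fun s => F (f s) (g s) := by
  classical
  obtain ⟨a, ha, hfa⟩ := hf
  obtain ⟨b, hb, hgb⟩ := hg
  refine ⟨a ∪ b, fun i hi => (Finset.mem_union.1 hi).elim (ha i) (hb i), fun s t h => ?_⟩
  beta_reduce
  rw [hfa fun i hi => h i (Finset.mem_union_left _ hi),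
    hgb fun i hi => h i (Finset.mem_union_right _ hi)]

theorem FinDep.mono {γ : Ordinal.{u}} {f : (Ordinal.{u} → K) → T} (hf : FinDep γ f) (h : γ ≤ β) :
    FinDep β f :=
  let ⟨a, ha, hfa⟩ := hf
  ⟨a, fun i hi => (ha i hi).trans_le h, hfa⟩

theorem FinDep.dependsOn {f : (Ordinal.{u} → K) → T} (hf : FinDep β f) :
    DependsOn f (Set.Iio β) :=
  let ⟨_, ha, hfa⟩ := hf
  hfa.mono ha

/-- Łoś's theorem for negation. -/
theorem FinDep.eventually_or {U : Ultrafilter K} {P : (Ordinal.{u} → K) → Prop} (hP : FinDep β P) :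
    (∀ᶠ s in prodFilter U β, P s) ∨ ∀ᶠ s in prodFilter U β, ¬ P s :=
  let ⟨a, ha, hPa⟩ := hP
  eventually_or_eventually_not a ha hPa

theorem FinDep.eventually_not {U : Ultrafilter K} {P : (Ordinal.{u} → K) → Prop}
    (hP : FinDep β P) :
    (¬ ∀ᶠ s in prodFilter U β, P s) ↔ ∀ᶠ s in prodFilter U β, ¬ P s := by
  refine ⟨fun h => hP.eventually_or.resolve_left h, fun h h' => ?_⟩
  obtain ⟨s, h1, h2⟩ := (h.and h').exists
  exact h1 h2

end FinDep

/-! ### Collapsing the functions of finitely many coordinates -/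

theorem mem_ofSmall {s : Set ZFSet.{u}} (h : Small.{u} s) {x : ZFSet.{u}} :
    x ∈ ofSmall s ↔ x ∈ s := by
  rw [ofSmall, dif_pos h]
  have : ZFSet.coeEquiv (ZFSet.coeEquiv.symm ⟨s, h⟩) = ⟨s, h⟩ := Equiv.apply_symm_apply _ _
  have h2 : ((ZFSet.coeEquiv.symm ⟨s, h⟩ : ZFSet.{u}) : Set ZFSet.{u}) = s :=
    congrArg Subtype.val this
  rw [← SetLike.mem_coe, h2]

theorem collapse_eq {T : Type (u + 1)} {E : T → T → Prop} (h : WellFounded E) (x : T) :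
    collapse E x = ofSmall (Set.range fun y : {y : T // E y x} => collapse E y.1) := by
  unfold collapse
  rw [dif_pos h, h.fix_eq]

section Rep

variable {K : Type (u + 1)} {U : Ultrafilter K} {κ : Cardinal.{u}} {β : Ordinal.{u}}

/-- The functions of finitely many coordinates below `β`, which represent the elements of the
`β`-th iterate. -/
abbrev Rep (K : Type (u + 1)) (β : Ordinal.{u}) : Type (u + 1) :=
  {f : (Ordinal.{u} → K) → ZFSet.{u} // FinDep β f}

/-- Membership almost everywhere. -/
def RepMem (U : Ultrafilter K) (β : Ordinal.{u}) (f g : Rep K β) : Prop :=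
  ∀ᶠ s in prodFilter U β, f.1 s ∈ g.1 s

/-- By countable completeness, one sequence `s` would turn a descending sequence of functions into a
descending sequence of sets. -/
theorem repMem_wf (hU : LtComplete (U : Filter K) κ) (hκ : Cardinal.aleph0 < κ)
    (β : Ordinal.{u}) : WellFounded (RepMem U β) := by
  rw [wellFounded_iff_isEmpty_descending_chain]
  refine ⟨fun ⟨f, hf⟩ => ?_⟩
  have h := hU.prodFilter β (ULift.{u} ℕ) (fun n s => (f (n.down + 1)).1 s ∈ (f n.down).1 s)
    (by simpa using hκ) fun n => hf n.down
  obtain ⟨s, hs⟩ := h.exists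
  exact (wellFounded_iff_isEmpty_descending_chain.1 ZFSet.mem_wf).false
    ⟨fun n => (f n).1 s, fun n => hs ⟨n⟩⟩

open Classical in
/-- The element of the `β`-th iterate represented by `f`: the Mostowski collapse of `f` with
respect to membership almost everywhere (`∅` if `f` depends on infinitely many coordinates). -/
noncomputable def rho (U : Ultrafilter K) (β : Ordinal.{u})
    (f : (Ordinal.{u} → K) → ZFSet.{u}) : ZFSet.{u} :=
  if h : FinDep β f then collapse (RepMem U β) ⟨f, h⟩ else ∅

theorem rho_eq_ofSmall (hwf : WellFounded (RepMem U β)) {f : (Ordinal.{u} → K) → ZFSet.{u}}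
    (hf : FinDep β f) :
    rho U β f = ofSmall
      {z | ∃ g, FinDep β g ∧ (∀ᶠ s in prodFilter U β, g s ∈ f s) ∧ rho U β g = z} := by
  rw [rho, dif_pos hf, collapse_eq hwf]
  congr 1
  ext z
  constructor
  · rintro ⟨⟨g, hg⟩, rfl⟩
    exact ⟨g.1, g.2, hg, by rw [rho, dif_pos g.2]⟩
  · rintro ⟨g, hg, hgf, rfl⟩
    exact ⟨⟨⟨g, hg⟩, hgf⟩, by rw [rho, dif_pos hg]⟩

theorem rho_congr (hwf : WellFounded (RepMem U β)) {f g : (Ordinal.{u} → K) → ZFSet.{u}}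
    (hf : FinDep β f) (hg : FinDep β g) (h : ∀ᶠ s in prodFilter U β, f s = g s) :
    rho U β f = rho U β g := by
  rw [rho_eq_ofSmall hwf hf, rho_eq_ofSmall hwf hg]
  have h' : ∀ k : (Ordinal.{u} → K) → ZFSet.{u}, (∀ᶠ s in prodFilter U β, k s ∈ f s) ↔
      ∀ᶠ s in prodFilter U β, k s ∈ g s := fun k =>
    eventually_congr (h.mono fun s hs => by rw [hs])
  simp only [h']

/-- A member of `f` almost everywhere can be changed to take all its values in the small set
`⋃ s, f s ∪ {∅}`, so `f` has only a set of members modulo equality almost everywhere. -/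
theorem small_rho_mem [Small.{u} K] (hwf : WellFounded (RepMem U β))
    {f : (Ordinal.{u} → K) → ZFSet.{u}} (hf : FinDep β f) :
    Small.{u} {z | ∃ g, FinDep β g ∧ (∀ᶠ s in prodFilter U β, g s ∈ f s) ∧ rho U β g = z} := by
  classical
  obtain ⟨k₀, -⟩ := U.nonempty_of_mem Filter.univ_mem
  let ext : (Set.Iio β → K) → Ordinal.{u} → K := fun r i => if h : i < β then r ⟨i, h⟩ else k₀
  let res : (Ordinal.{u} → K) → Set.Iio β → K := fun s i => s i.1
  have hext : ∀ s, ∀ i < β, ext (res s) i = s i := fun s i hi => by simp [ext, res, hi]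
  let A : Set ZFSet.{u} := ⋃ r : Set.Iio β → K, ((insert ∅ (f (ext r)) : ZFSet.{u}) : Set ZFSet.{u})
  have : Small.{u} (Set.Iio β → K) := small_Pi _
  have : ∀ r, Small.{u} ((insert ∅ (f (ext r)) : ZFSet.{u}) : Set ZFSet.{u}) := fun r =>
    ZFSet.small_coe _
  have : Small.{u} A := small_iUnion _
  have : Small.{u} ((Set.Iio β → K) → A) := small_Pi _
  refine small_subset (s := Set.range fun h : (Set.Iio β → K) → A =>
    rho U β fun s => (h (res s)).1) ?_
  rintro z ⟨g, hg, hgf, rfl⟩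
  let g' : (Ordinal.{u} → K) → ZFSet.{u} := fun s => if g s ∈ f s then g s else ∅
  have hg' : FinDep β g' := hg.comp₂ hf fun x y => if x ∈ y then x else ∅
  have hgg' : rho U β g' = rho U β g :=
    rho_congr hwf hg' hg (hgf.mono fun s hs => if_pos hs)
  have hmem : ∀ r, g' (ext r) ∈ A := fun r => Set.mem_iUnion.2 ⟨r, by
    rw [SetLike.mem_coe, ZFSet.mem_insert_iff]
    by_cases h : g (ext r) ∈ f (ext r)
    · simp [g', h]
    · simp [g', h]⟩
  refine ⟨fun r => ⟨g' (ext r), hmem r⟩, ?_⟩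
  rw [← hgg']
  exact congrArg (rho U β) (funext fun s => hg'.dependsOn fun i hi => hext s i hi)

theorem mem_rho_iff [Small.{u} K] (hwf : WellFounded (RepMem U β))
    {f : (Ordinal.{u} → K) → ZFSet.{u}} (hf : FinDep β f) {z : ZFSet.{u}} :
    z ∈ rho U β f ↔
      ∃ g, FinDep β g ∧ (∀ᶠ s in prodFilter U β, g s ∈ f s) ∧ rho U β g = z := by
  rw [rho_eq_ofSmall hwf hf, mem_ofSmall (small_rho_mem hwf hf), Set.mem_ofPred_eq]

/-- Extensionality of the relation of membership almost everywhere, modulo equality almost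
everywhere. -/
theorem rho_eq_iff [Small.{u} K] (hwf : WellFounded (RepMem U β))
    {f g : (Ordinal.{u} → K) → ZFSet.{u}} (hf : FinDep β f) (hg : FinDep β g) :
    rho U β f = rho U β g ↔ ∀ᶠ s in prodFilter U β, f s = g s := by
  classical
  refine ⟨fun h => ?_, rho_congr hwf hf hg⟩
  suffices H : ∀ x : Rep K β, ∀ g, FinDep β g → rho U β x.1 = rho U β g →
      ∀ᶠ s in prodFilter U β, x.1 s = g s from H ⟨f, hf⟩ g hg h
  clear h hg hf f g
  intro x
  induction x using hwf.induction with
  | _ x ih =>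
  obtain ⟨f, hf⟩ := x
  intro g hg hfg
  by_contra hne
  -- a witness to `f s ≠ g s`, chosen from the pair `(f s, g s)` so that it depends on finitely many
  -- coordinates
  have hw : ∀ x y : ZFSet.{u}, ∃ z, x ≠ y → ¬ (z ∈ x ↔ z ∈ y) := fun x y => by
    by_contra! h
    exact (h ∅).1 (ZFSet.ext fun z => (h z).2)
  choose w hw using hw
  have hd := ((hf.comp₂ hg fun x y => x = y).eventually_not (U := U)).1 hne
  have hwd : FinDep β fun s => w (f s) (g s) := hf.comp₂ hg w
  rcases (hwd.comp₂ hf fun x y => x ∈ y).eventually_or (U := U) with h1 | h1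
  · have h2 : rho U β (fun s => w (f s) (g s)) ∈ rho U β g := by
      rw [← hfg]
      exact (mem_rho_iff hwf hf).2 ⟨_, hwd, h1, rfl⟩
    obtain ⟨k, hk, hkg, hkw⟩ := (mem_rho_iff hwf hg).1 h2
    obtain ⟨s, h3, h4, h5, h6⟩ :=
      (hd.and (h1.and (hkg.and (ih ⟨_, hwd⟩ h1 k hk hkw.symm)))).exists
    refine hw (f s) (g s) h3 ⟨fun _ => ?_, fun _ => h4⟩
    have h7 : w (f s) (g s) = k s := h6
    rwa [h7]
  · have h2 : ∀ᶠ s in prodFilter U β, w (f s) (g s) ∈ g s := by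
      filter_upwards [hd, h1] with s h3 h4
      by_contra h5
      exact hw _ _ h3 ⟨fun h => absurd h h4, fun h => absurd h h5⟩
    have h3 : rho U β (fun s => w (f s) (g s)) ∈ rho U β f := by
      rw [hfg]
      exact (mem_rho_iff hwf hg).2 ⟨_, hwd, h2, rfl⟩
    obtain ⟨k, hk, hkf, hkw⟩ := (mem_rho_iff hwf hf).1 h3
    obtain ⟨s, h4, h5, h6⟩ := (h1.and (hkf.and (ih ⟨k, hk⟩ hkf _ hwd hkw))).exists
    have h7 : k s = w (f s) (g s) := h6
    exact h4 (h7 ▸ h5)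

theorem rho_mem_iff [Small.{u} K] (hwf : WellFounded (RepMem U β))
    {f g : (Ordinal.{u} → K) → ZFSet.{u}} (hf : FinDep β f) (hg : FinDep β g) :
    rho U β f ∈ rho U β g ↔ ∀ᶠ s in prodFilter U β, f s ∈ g s := by
  refine ⟨fun h => ?_, fun h => (mem_rho_iff hwf hg).2 ⟨f, hf, h, rfl⟩⟩
  obtain ⟨k, hk, hkg, hkf⟩ := (mem_rho_iff hwf hg).1 h
  filter_upwards [hkg, (rho_eq_iff hwf hk hf).1 hkf] with s h1 h2
  rwa [← h2]

/-- A map respecting equality and membership whose values have only values as members is the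
Mostowski collapse. -/
theorem quotCollapse_eq {T : Type (u + 1)} {r e : T → T → Prop} (p : T → ZFSet.{u})
    (hr : ∀ x y, r x y ↔ p x = p y) (he : ∀ x y, e x y ↔ p x ∈ p y)
    (hp : ∀ y, ∀ z ∈ p y, ∃ x, p x = z) (x : T) : quotCollapse r e x = p x := by
  let q : Quot r → ZFSet.{u} := Quot.lift p fun x y h => (hr x y).1 h
  let E : Quot r → Quot r → Prop :=
    fun a b => ∃ y z : T, a = Quot.mk r y ∧ b = Quot.mk r z ∧ e y z
  have hE : ∀ a b, E a b ↔ q a ∈ q b := by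
    intro a b
    constructor
    · rintro ⟨y, z, rfl, rfl, h⟩
      exact (he y z).1 h
    · induction a using Quot.ind with | _ y =>
      induction b using Quot.ind with | _ z =>
      exact fun h => ⟨y, z, rfl, rfl, (he y z).2 h⟩
  have hwf : WellFounded E :=
    Subrelation.wf (fun {a b} h => (hE a b).1 h) (InvImage.wf q ZFSet.mem_wf)
  have key : ∀ a, collapse E a = q a := by
    intro a
    induction a using hwf.induction with
    | _ a ih =>
    have hset : (Set.range fun y : {y : Quot r // E y a} => collapse E y.1) =
        (q a : Set ZFSet.{u}) := by
      ext z
      constructor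
      · rintro ⟨⟨b, hb⟩, rfl⟩
        change collapse E b ∈ q a
        rw [ih b hb]
        exact (hE b a).1 hb
      · intro hz
        induction a using Quot.ind with | _ y =>
        obtain ⟨x, rfl⟩ := hp y z hz
        have hx : E (Quot.mk r x) (Quot.mk r y) := (hE _ _).2 hz
        exact ⟨⟨_, hx⟩, ih _ hx⟩
    rw [collapse_eq hwf, hset]
    ext z
    exact mem_ofSmall (ZFSet.small_coe _)
  exact key (Quot.mk r x)

end Rep

/-! ### Łoś's theorem for the set operations needed -/

section Los

variable {K : Type (u + 1)} {U : Ultrafilter K} {β : Ordinal.{u}}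

/-- The elements represented by functions of finitely many coordinates below `β`. -/
def Itr (U : Ultrafilter K) (β : Ordinal.{u}) : Set ZFSet.{u} :=
  {z | ∃ f, FinDep β f ∧ rho U β f = z}

theorem rho_mem_itr {f : (Ordinal.{u} → K) → ZFSet.{u}} (hf : FinDep β f) : rho U β f ∈ Itr U β :=
  ⟨f, hf, rfl⟩

/-- Łoś's theorem for the existential quantifier: witnesses can be chosen as a function of finitely
many coordinates. -/
theorem FinDep.exists_of_eventually {X Y : Type*} [Nonempty Y] {t : (Ordinal.{u} → K) → X}
    (ht : FinDep β t) {Q : X → Y → Prop} (h : ∀ᶠ s in prodFilter U β, ∃ v, Q (t s) v) :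
    ∃ v : (Ordinal.{u} → K) → Y, FinDep β v ∧ ∀ᶠ s in prodFilter U β, Q (t s) (v s) :=
  ⟨fun s => Classical.epsilon (Q (t s)), ht.comp fun x => Classical.epsilon (Q x),
    h.mono fun _ hs => Classical.epsilon_spec hs⟩

variable [Small.{u} K]

theorem itr_transitive (hwf : WellFounded (RepMem U β)) {x z : ZFSet.{u}} (hx : x ∈ Itr U β)
    (hz : z ∈ x) : z ∈ Itr U β := by
  obtain ⟨f, hf, rfl⟩ := hx
  obtain ⟨g, hg, -, rfl⟩ := (mem_rho_iff hwf hf).1 hz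
  exact rho_mem_itr hg

theorem mem_itr_of_pair (hwf : WellFounded (RepMem U β)) {x a b : ZFSet.{u}} (hx : x ∈ Itr U β)
    (h : ZFSet.pair a b ∈ x) : a ∈ Itr U β ∧ b ∈ Itr U β := by
  have h1 : ({a, b} : ZFSet.{u}) ∈ Itr U β :=
    itr_transitive hwf (itr_transitive hwf hx h) (by simp [ZFSet.pair])
  exact ⟨itr_transitive hwf h1 (by simp), itr_transitive hwf h1 (by simp)⟩

theorem rho_upair (hwf : WellFounded (RepMem U β)) {f g : (Ordinal.{u} → K) → ZFSet.{u}}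
    (hf : FinDep β f) (hg : FinDep β g) :
    rho U β (fun s => {f s, g s}) = {rho U β f, rho U β g} := by
  ext z
  rw [mem_rho_iff hwf (hf.comp₂ hg fun x y => ({x, y} : ZFSet.{u})), ZFSet.mem_pair]
  constructor
  · rintro ⟨k, hk, hkfg, rfl⟩
    rw [rho_eq_iff hwf hk hf, rho_eq_iff hwf hk hg]
    refine (hk.comp₂ hf fun x y => x = y).eventually_or.imp_right fun h => ?_
    filter_upwards [h, hkfg] with s h1 h2
    exact (ZFSet.mem_pair.1 h2).resolve_left h1
  · rintro (rfl | rfl)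
    · exact ⟨f, hf, .of_forall fun s => by simp, rfl⟩
    · exact ⟨g, hg, .of_forall fun s => by simp, rfl⟩

theorem rho_pair (hwf : WellFounded (RepMem U β)) {f g : (Ordinal.{u} → K) → ZFSet.{u}}
    (hf : FinDep β f) (hg : FinDep β g) :
    rho U β (fun s => ZFSet.pair (f s) (g s)) = ZFSet.pair (rho U β f) (rho U β g) := by
  have h1 : ∀ x y : ZFSet.{u}, ZFSet.pair x y = {{x, x}, {x, y}} := fun x y => by
    rw [ZFSet.pair_eq_singleton]; rfl
  simp only [h1]
  rw [rho_upair hwf (hf.comp fun x => ({x, x} : ZFSet.{u}))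
    (hf.comp₂ hg fun x y => ({x, y} : ZFSet.{u})), rho_upair hwf hf hf, rho_upair hwf hf hg]

theorem pair_rho_mem_iff (hwf : WellFounded (RepMem U β))
    {f g k : (Ordinal.{u} → K) → ZFSet.{u}} (hf : FinDep β f) (hg : FinDep β g)
    (hk : FinDep β k) :
    ZFSet.pair (rho U β f) (rho U β g) ∈ rho U β k ↔
      ∀ᶠ s in prodFilter U β, ZFSet.pair (f s) (g s) ∈ k s := by
  rw [← rho_pair hwf hf hg, rho_mem_iff hwf (hf.comp₂ hg ZFSet.pair) hk]

end Los

/-! ### The successor step -/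

section Succ

variable {κ : Cardinal.{u}} {μ : ZFSet.{u}} {β : Ordinal.{u}}

/-- The value at `x` of a function `f` coded as a set of pairs; arbitrary if there is none. -/
noncomputable def app (f x : ZFSet.{u}) : ZFSet.{u} :=
  Classical.epsilon fun v => ZFSet.pair x v ∈ f

theorem app_eq {f x v : ZFSet.{u}} (hf : ∃! v, ZFSet.pair x v ∈ f) (hv : ZFSet.pair x v ∈ f) :
    app f x = v :=
  hf.unique (Classical.epsilon_spec (p := fun v => ZFSet.pair x v ∈ f) ⟨v, hv⟩) hv

theorem pair_app_mem {f x : ZFSet.{u}} (hf : ∃! v, ZFSet.pair x v ∈ f) :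
    ZFSet.pair x (app f x) ∈ f :=
  Classical.epsilon_spec (p := fun v => ZFSet.pair x v ∈ f) hf.exists

theorem IsMeasure.repMem_wf (hμ : IsMeasure κ μ) (β : Ordinal.{u}) :
    WellFounded (RepMem hμ.ultrafilter β) :=
  IterUlt.repMem_wf hμ.ltComplete hμ.uncountable β

theorem IsMeasure.nonempty_pt (hμ : IsMeasure κ μ) : Nonempty (Pt κ) :=
  (hμ.ultrafilter.nonempty_of_mem Filter.univ_mem).to_type

theorem IsMeasure.mem_rho_ordSet_iff (hμ : IsMeasure κ μ) {z : ZFSet.{u}} :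
    z ∈ rho hμ.ultrafilter β (fun _ => ordSet κ) ↔
      ∃ x : (Ordinal.{u} → Pt κ) → Pt κ, FinDep β x ∧
        rho hμ.ultrafilter β (fun s => (x s).1) = z := by
  have hwf := hμ.repMem_wf β
  have := hμ.nonempty_pt
  rw [mem_rho_iff hwf (FinDep.const _)]
  constructor
  · rintro ⟨g, hg, hgκ, rfl⟩
    obtain ⟨x, hx, hxg⟩ := hg.exists_of_eventually (Q := fun y (v : Pt κ) => v.1 = y)
      (hgκ.mono fun s hs => ⟨⟨g s, hs⟩, rfl⟩)
    exact ⟨x, hx, rho_congr hwf (hx.comp Subtype.val) hg hxg⟩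
  · rintro ⟨x, hx, rfl⟩
    exact ⟨_, hx.comp Subtype.val, .of_forall fun s => (x s).2, rfl⟩

/-- A function in `M_β` with domain `j_{0,β}(κ)` is represented by functions with domain `κ`. -/
theorem IsMeasure.eventually_existsUnique (hμ : IsMeasure κ μ)
    {f : (Ordinal.{u} → Pt κ) → ZFSet.{u}} (hf : FinDep β f) {y : ZFSet.{u}}
    (hfy : ZFSet.IsFunc (rho hμ.ultrafilter β fun _ => ordSet κ) y (rho hμ.ultrafilter β f)) :
    ∀ᶠ s in prodFilter hμ.ultrafilter β, ∀ x : Pt κ, ∃! v, ZFSet.pair x.1 v ∈ f s := by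
  have hwf := hμ.repMem_wf β
  have := hμ.nonempty_pt
  by_contra hne
  have h1 := ((hf.comp fun g => ∀ x : Pt κ, ∃! v, ZFSet.pair x.1 v ∈ g).eventually_not
    (U := hμ.ultrafilter)).1 hne
  obtain ⟨x, hx, h2⟩ := hf.exists_of_eventually
    (Q := fun g (x : Pt κ) => ¬ ∃! v, ZFSet.pair x.1 v ∈ g)
    (h1.mono fun s hs => not_forall.1 hs)
  have hx' : FinDep β fun s => (x s).1 := hx.comp Subtype.val
  obtain ⟨v, hv, huniq⟩ := hfy.2 _ (hμ.mem_rho_ordSet_iff.2 ⟨x, hx, rfl⟩)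
  obtain ⟨v, hvd, rfl⟩ := (mem_itr_of_pair hwf (rho_mem_itr hf) hv).2
  have h3 := (pair_rho_mem_iff hwf hx' hvd hf).1 hv
  have h4 : ∀ᶠ s in prodFilter hμ.ultrafilter β, ∃ w, ZFSet.pair (x s).1 w ∈ f s ∧ w ≠ v s := by
    filter_upwards [h2, h3] with s h5 h6
    by_contra! h7
    exact h5 ⟨v s, h6, h7⟩
  -- a second value almost everywhere would represent a second value of the function in `M_β`
  obtain ⟨w, hw, h5⟩ := ((hx'.comp₂ hf Prod.mk).comp₂ hvd Prod.mk).exists_of_eventually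
    (Q := fun t w => ZFSet.pair t.1.1 w ∈ t.1.2 ∧ w ≠ t.2) h4
  have h6 := huniq _ ((pair_rho_mem_iff hwf hx' hw hf).2 (h5.mono fun s h => h.1))
  obtain ⟨s, h7, h8⟩ := (h5.and ((rho_eq_iff hwf hw hvd).1 h6)).exists
  exact h7.2 h8

/-- Łoś's theorem for membership in `j_{0,β}(μ)`. -/
theorem IsMeasure.sep_mem_rho_iff (hμ : IsMeasure κ μ) {Φ : ZFSet.{u} → Prop}
    {φ : (Ordinal.{u} → Pt κ) → Pt κ → Prop} (hφ : FinDep β φ)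
    (h : ∀ x : (Ordinal.{u} → Pt κ) → Pt κ, FinDep β x →
      (Φ (rho hμ.ultrafilter β fun s => (x s).1) ↔
        ∀ᶠ s in prodFilter hμ.ultrafilter β, φ s (x s))) :
    ZFSet.sep Φ (rho hμ.ultrafilter β fun _ => ordSet κ) ∈ rho hμ.ultrafilter β (fun _ => μ) ↔
      ∀ᶠ s in prodFilter hμ.ultrafilter β, ∀ᶠ x in (hμ.ultrafilter : Filter (Pt κ)), φ s x := by
  have hwf := hμ.repMem_wf β
  have := hμ.nonempty_pt
  have hs : ZFSet.sep Φ (rho hμ.ultrafilter β fun _ => ordSet κ) =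
      rho hμ.ultrafilter β fun s => ptSep (φ s) := by
    ext z
    rw [ZFSet.mem_sep, hμ.mem_rho_ordSet_iff, mem_rho_iff hwf (hφ.comp ptSep)]
    constructor
    · rintro ⟨⟨x, hx, rfl⟩, h1⟩
      exact ⟨_, hx.comp Subtype.val,
        ((h x hx).1 h1).mono fun s hs => mem_ptSep.2 ⟨(x s).2, hs⟩, rfl⟩
    · rintro ⟨g, hg, h1, rfl⟩
      obtain ⟨x, hx, h2⟩ := (hg.comp₂ hφ Prod.mk).exists_of_eventually
        (Q := fun t (x : Pt κ) => x.1 = t.1 ∧ t.2 x)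
        (h1.mono fun s hs => let ⟨h3, h4⟩ := mem_ptSep.1 hs; ⟨⟨g s, h3⟩, rfl, h4⟩)
      have h3 := rho_congr hwf (hx.comp Subtype.val) hg (h2.mono fun s h => h.1)
      rw [← h3]
      exact ⟨⟨x, hx, rfl⟩, (h x hx).2 (h2.mono fun s h => h.2)⟩
  rw [hs, rho_mem_iff hwf (hφ.comp ptSep) (FinDep.const μ)]
  rfl

/-- The function on one more coordinate represented by a function `f` in `M_β` with domain
`j_{0,β}(κ)`. -/
noncomputable def lastApp (β : Ordinal.{u}) (f : (Ordinal.{u} → Pt κ) → ZFSet.{u}) :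
    (Ordinal.{u} → Pt κ) → ZFSet.{u} :=
  fun s => app (f s) (s β).1

theorem FinDep.lastApp {f : (Ordinal.{u} → Pt κ) → ZFSet.{u}} (hf : FinDep β f) :
    FinDep (β + 1) (lastApp β f) :=
  (hf.mono (le_add_of_nonneg_right zero_le)).comp₂ (FinDep.eval (lt_add_one β))
    fun f x => app f x.1

/-- Fubini for a predicate of the last coordinate and a parameter depending on the earlier ones. -/
theorem eventually_last_iff {U : Ultrafilter (Pt κ)} {X : Type*} {t : (Ordinal.{u} → Pt κ) → X}
    (ht : FinDep β t) (Q : X → Pt κ → Prop) :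
    (∀ᶠ s in prodFilter U (β + 1), Q (t s) (s β)) ↔
      ∀ᶠ s in prodFilter U β, ∀ᶠ x in (U : Filter (Pt κ)), Q (t s) x := by
  rw [eventually_prodFilter_add_one ((ht.mono (le_add_of_nonneg_right zero_le)).comp₂
    (FinDep.eval (lt_add_one β)) Q).dependsOn]
  refine eventually_congr (.of_forall fun s => eventually_congr (.of_forall fun x => ?_))
  have h : t (Function.update s β x) = t s := ht.dependsOn fun i hi =>
    Function.update_of_ne (ne_of_lt hi) _ _
  rw [h, Function.update_self]

section AE

variable (hμ : IsMeasure κ μ) {f g : (Ordinal.{u} → Pt κ) → ZFSet.{u}}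
  (hf : FinDep β f) (hg : FinDep β g)
  (F G : Fn (Itr hμ.ultrafilter β) (rho hμ.ultrafilter β fun _ => ordSet κ))
  (hF : rho hμ.ultrafilter β f = F.1) (hG : rho hμ.ultrafilter β g = G.1)

include hf hg hF hG

/-- Two functions in `M_β` agree almost everywhere with respect to `j_{0,β}(μ)` iff the functions
of one more coordinate that they give represent the same element of `M_{β+1}`. -/
theorem IsMeasure.aeEq_iff : aeEq (rho hμ.ultrafilter β fun _ => μ) F G ↔
    rho hμ.ultrafilter (β + 1) (lastApp β f) = rho hμ.ultrafilter (β + 1) (lastApp β g) := by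
  have hwf := hμ.repMem_wf β
  have hfg := hf.comp₂ hg Prod.mk
  obtain ⟨y, hy⟩ := F.2.2
  obtain ⟨y', hy'⟩ := G.2.2
  rw [← hF] at hy
  rw [← hG] at hy'
  rw [rho_eq_iff (hμ.repMem_wf _) hf.lastApp hg.lastApp]
  refine .trans ?_ (eventually_last_iff hfg fun t x => app t.1 x.1 = app t.2 x.1).symm
  rw [aeEq, ← hF, ← hG]
  rw [hμ.sep_mem_rho_iff (hfg.comp fun t (x : Pt κ) =>
    ∃ v, ZFSet.pair x.1 v ∈ t.1 ∧ ZFSet.pair x.1 v ∈ t.2)]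
  · refine eventually_congr ?_
    filter_upwards [hμ.eventually_existsUnique hf hy, hμ.eventually_existsUnique hg hy']
      with s h1 h2
    refine eventually_congr (.of_forall fun x => ?_)
    constructor
    · rintro ⟨v, h3, h4⟩
      rw [app_eq (h1 x) h3, app_eq (h2 x) h4]
    · exact fun h3 => ⟨_, pair_app_mem (h1 x), h3 ▸ pair_app_mem (h2 x)⟩
  · intro x hx
    have hx' : FinDep β fun s => (x s).1 := hx.comp Subtype.val
    constructor
    · rintro ⟨v, h1, h2⟩
      obtain ⟨v, hv, rfl⟩ := (mem_itr_of_pair hwf (rho_mem_itr hf) h1).2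
      filter_upwards [(pair_rho_mem_iff hwf hx' hv hf).1 h1,
        (pair_rho_mem_iff hwf hx' hv hg).1 h2] with s h3 h4
      exact ⟨_, h3, h4⟩
    · intro h
      obtain ⟨v, hv, h1⟩ := (hfg.comp₂ hx' Prod.mk).exists_of_eventually
        (Q := fun t v => ZFSet.pair t.2 v ∈ t.1.1 ∧ ZFSet.pair t.2 v ∈ t.1.2) h
      exact ⟨_, (pair_rho_mem_iff hwf hx' hv hf).2 (h1.mono fun s h => h.1),
        (pair_rho_mem_iff hwf hx' hv hg).2 (h1.mono fun s h => h.2)⟩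

theorem IsMeasure.aeMem_iff : aeMem (rho hμ.ultrafilter β fun _ => μ) F G ↔
    rho hμ.ultrafilter (β + 1) (lastApp β f) ∈ rho hμ.ultrafilter (β + 1) (lastApp β g) := by
  have hwf := hμ.repMem_wf β
  have hfg := hf.comp₂ hg Prod.mk
  obtain ⟨y, hy⟩ := F.2.2
  obtain ⟨y', hy'⟩ := G.2.2
  rw [← hF] at hy
  rw [← hG] at hy'
  rw [rho_mem_iff (hμ.repMem_wf _) hf.lastApp hg.lastApp]
  refine .trans ?_ (eventually_last_iff hfg fun t x => app t.1 x.1 ∈ app t.2 x.1).symm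
  rw [aeMem, ← hF, ← hG]
  rw [hμ.sep_mem_rho_iff (hfg.comp fun t (x : Pt κ) =>
    ∃ v w, ZFSet.pair x.1 v ∈ t.1 ∧ ZFSet.pair x.1 w ∈ t.2 ∧ v ∈ w)]
  · refine eventually_congr ?_
    filter_upwards [hμ.eventually_existsUnique hf hy, hμ.eventually_existsUnique hg hy']
      with s h1 h2
    refine eventually_congr (.of_forall fun x => ?_)
    constructor
    · rintro ⟨v, w, h3, h4, h5⟩
      rwa [app_eq (h1 x) h3, app_eq (h2 x) h4]
    · exact fun h3 => ⟨_, _, pair_app_mem (h1 x), pair_app_mem (h2 x), h3⟩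
  · intro x hx
    have hx' : FinDep β fun s => (x s).1 := hx.comp Subtype.val
    constructor
    · rintro ⟨v, w, h1, h2, h3⟩
      obtain ⟨v, hv, rfl⟩ := (mem_itr_of_pair hwf (rho_mem_itr hf) h1).2
      obtain ⟨w, hw, rfl⟩ := (mem_itr_of_pair hwf (rho_mem_itr hg) h2).2
      filter_upwards [(pair_rho_mem_iff hwf hx' hv hf).1 h1,
        (pair_rho_mem_iff hwf hx' hw hg).1 h2, (rho_mem_iff hwf hv hw).1 h3] with s h4 h5 h6
      exact ⟨_, _, h4, h5, h6⟩
    · intro h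
      obtain ⟨v, hv, h1⟩ := (hfg.comp₂ hx' Prod.mk).exists_of_eventually
        (Q := fun t v => ∃ w, ZFSet.pair t.2 v ∈ t.1.1 ∧ ZFSet.pair t.2 w ∈ t.1.2 ∧ v ∈ w) h
      obtain ⟨w, hw, h2⟩ := ((hfg.comp₂ hx' Prod.mk).comp₂ hv Prod.mk).exists_of_eventually
        (Q := fun t w => ZFSet.pair t.1.2 t.2 ∈ t.1.1.1 ∧ ZFSet.pair t.1.2 w ∈ t.1.1.2 ∧ t.2 ∈ w)
        h1
      exact ⟨_, _, (pair_rho_mem_iff hwf hx' hv hf).2 (h2.mono fun s h => h.1),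
        (pair_rho_mem_iff hwf hx' hw hg).2 (h2.mono fun s h => h.2.1),
        (rho_mem_iff hwf hv hw).2 (h2.mono fun s h => h.2.2)⟩

end AE

/-- The function with domain `κ` which the last coordinate of a function of one more coordinate
gives when the others are fixed. -/
noncomputable def graph (β : Ordinal.{u}) (h : (Ordinal.{u} → Pt κ) → ZFSet.{u}) :
    (Ordinal.{u} → Pt κ) → ZFSet.{u} :=
  fun s => ZFSet.range fun x : Pt κ => ZFSet.pair x.1 (h (Function.update s β x))

theorem FinDep.update {h : (Ordinal.{u} → Pt κ) → ZFSet.{u}} (hh : FinDep (β + 1) h) :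
    FinDep β fun s x => h (Function.update s β x) := by
  classical
  obtain ⟨a, ha, hha⟩ := hh
  refine ⟨a.erase β, fun i hi => ?_, fun s t hst => funext fun x => hha fun i hi => ?_⟩
  · exact (Order.lt_add_one_iff.1 (ha i (Finset.mem_of_mem_erase hi))).lt_of_ne
      (Finset.ne_of_mem_erase hi)
  · by_cases hiβ : i = β
    · subst hiβ
      simp
    · rw [Function.update_of_ne hiβ, Function.update_of_ne hiβ]
      exact hst i (Finset.mem_erase.2 ⟨hiβ, hi⟩)

theorem FinDep.graph {h : (Ordinal.{u} → Pt κ) → ZFSet.{u}} (hh : FinDep (β + 1) h) :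
    FinDep β (graph β h) :=
  hh.update.comp fun k => ZFSet.range fun x : Pt κ => ZFSet.pair x.1 (k x)

theorem pair_mem_graph {h : (Ordinal.{u} → Pt κ) → ZFSet.{u}} {s : Ordinal.{u} → Pt κ} {x : Pt κ}
    {v : ZFSet.{u}} : ZFSet.pair x.1 v ∈ graph β h s ↔ v = h (Function.update s β x) := by
  rw [graph, ZFSet.mem_range]
  constructor
  · rintro ⟨x', hx'⟩
    obtain ⟨h1, h2⟩ := ZFSet.pair_inj.1 hx'
    rw [← h2, Subtype.ext h1]
  · rintro rfl
    exact ⟨x, rfl⟩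

theorem lastApp_graph (h : (Ordinal.{u} → Pt κ) → ZFSet.{u}) : lastApp β (graph β h) = h := by
  funext s
  have h1 : app (graph β h s) (s β).1 = h (Function.update s β (s β)) :=
    app_eq ⟨_, pair_mem_graph.2 rfl, fun v hv => pair_mem_graph.1 hv⟩ (pair_mem_graph.2 rfl)
  rw [lastApp, h1, Function.update_eq_self]

/-- The elements of the function represented by `graph β h` are the pairs represented by its values
at functions `x` of finitely many coordinates. -/
theorem IsMeasure.mem_rho_graph_iff (hμ : IsMeasure κ μ)
    {h : (Ordinal.{u} → Pt κ) → ZFSet.{u}} (hh : FinDep (β + 1) h) {z : ZFSet.{u}} :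
    z ∈ rho hμ.ultrafilter β (graph β h) ↔
      ∃ x : (Ordinal.{u} → Pt κ) → Pt κ, FinDep β x ∧
        z = ZFSet.pair (rho hμ.ultrafilter β fun s => (x s).1)
          (rho hμ.ultrafilter β fun s => h (Function.update s β (x s))) := by
  have hwf := hμ.repMem_wf β
  have := hμ.nonempty_pt
  have hv : ∀ x : (Ordinal.{u} → Pt κ) → Pt κ, FinDep β x →
      FinDep β fun s => h (Function.update s β (x s)) := fun x hx =>
    hh.update.comp₂ hx fun k x => k x
  constructor
  · intro hz
    obtain ⟨e, he, h1, rfl⟩ := (mem_rho_iff hwf hh.graph).1 hz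
    obtain ⟨x, hx, h2⟩ := (hh.update.comp₂ he Prod.mk).exists_of_eventually
      (Q := fun t (x : Pt κ) => ZFSet.pair x.1 (t.1 x) = t.2)
      (h1.mono fun s hs => ZFSet.mem_range.1 hs)
    refine ⟨x, hx, ?_⟩
    rw [← rho_pair hwf (hx.comp Subtype.val) (hv x hx)]
    exact rho_congr hwf he ((hx.comp Subtype.val).comp₂ (hv x hx) ZFSet.pair)
      (h2.mono fun s hs => hs.symm)
  · rintro ⟨x, hx, rfl⟩
    rw [pair_rho_mem_iff hwf (hx.comp Subtype.val) (hv x hx) hh.graph]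
    exact .of_forall fun s => pair_mem_graph.2 rfl

theorem IsMeasure.isFunc_graph (hμ : IsMeasure κ μ)
    {h : (Ordinal.{u} → Pt κ) → ZFSet.{u}} (hh : FinDep (β + 1) h) :
    ∃ y, ZFSet.IsFunc (rho hμ.ultrafilter β fun _ => ordSet κ) y
      (rho hμ.ultrafilter β (graph β h)) := by
  have hwf := hμ.repMem_wf β
  have hR : FinDep β fun s => ZFSet.range fun x : Pt κ => h (Function.update s β x) :=
    hh.update.comp fun k => ZFSet.range k
  refine ⟨rho hμ.ultrafilter β fun s => ZFSet.range fun x : Pt κ => h (Function.update s β x),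
    fun z hz => ?_, fun z hz => ?_⟩
  · obtain ⟨x, hx, rfl⟩ := (hμ.mem_rho_graph_iff hh).1 hz
    refine ZFSet.pair_mem_prod.2 ⟨hμ.mem_rho_ordSet_iff.2 ⟨x, hx, rfl⟩, ?_⟩
    rw [rho_mem_iff hwf (hh.update.comp₂ hx fun k x => k x) hR]
    exact .of_forall fun s => ZFSet.mem_range.2 ⟨x s, rfl⟩
  · obtain ⟨x, hx, rfl⟩ := hμ.mem_rho_ordSet_iff.1 hz
    refine ⟨_, (hμ.mem_rho_graph_iff hh).2 ⟨x, hx, rfl⟩, fun w hw => ?_⟩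
    obtain ⟨x', hx', h1⟩ := (hμ.mem_rho_graph_iff hh).1 hw
    obtain ⟨h2, rfl⟩ := ZFSet.pair_inj.1 h1
    have h3 := (rho_eq_iff hwf (hx.comp Subtype.val) (hx'.comp Subtype.val)).1 h2
    refine rho_congr hwf (hh.update.comp₂ hx' fun k x => k x) (hh.update.comp₂ hx fun k x => k x)
      (h3.mono fun s hs => ?_)
    rw [Subtype.ext hs]

/-- The choice of `f` among the representatives of one function in `M_β` does not matter. -/
theorem IsMeasure.rho_lastApp_congr (hμ : IsMeasure κ μ)
    {f g : (Ordinal.{u} → Pt κ) → ZFSet.{u}} (hf : FinDep β f) (hg : FinDep β g)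
    (h : rho hμ.ultrafilter β f = rho hμ.ultrafilter β g) :
    rho hμ.ultrafilter (β + 1) (lastApp β f) = rho hμ.ultrafilter (β + 1) (lastApp β g) := by
  have h1 := (rho_eq_iff (hμ.repMem_wf β) hf hg).1 h
  rw [← eventually_prodFilter_of_le (le_add_of_nonneg_right zero_le : β ≤ β + 1)
    (hf.comp₂ hg fun x y => x = y).dependsOn] at h1
  exact rho_congr (hμ.repMem_wf _) hf.lastApp hg.lastApp
    (h1.mono fun s hs => congrArg (app · (s β).1) hs)

/-- The ultrapower of `M_β` collapses as predicted: the class of the function represented by `f` is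
the element of `M_{β+1}` represented by `lastApp β f`. -/
theorem IsMeasure.ultClass_eq (hμ : IsMeasure κ μ)
    (F : Fn (Itr hμ.ultrafilter β) (rho hμ.ultrafilter β fun _ => ordSet κ))
    {f : (Ordinal.{u} → Pt κ) → ZFSet.{u}} (hf : FinDep β f)
    (hF : rho hμ.ultrafilter β f = F.1) :
    ultClass (rho hμ.ultrafilter β fun _ => μ) F =
      rho hμ.ultrafilter (β + 1) (lastApp β f) := by
  choose r hr hrF using fun F : Fn (Itr hμ.ultrafilter β)
    (rho hμ.ultrafilter β fun _ => ordSet κ) => F.2.1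
  refine (quotCollapse_eq (fun F => rho hμ.ultrafilter (β + 1) (lastApp β (r F)))
    (fun F G => hμ.aeEq_iff (hr F) (hr G) F G (hrF F) (hrF G))
    (fun F G => hμ.aeMem_iff (hr F) (hr G) F G (hrF F) (hrF G)) (fun F z hz => ?_) F).trans
    (hμ.rho_lastApp_congr (hr F) hf ((hrF F).trans hF.symm))
  obtain ⟨h, hh, -, rfl⟩ := (mem_rho_iff (hμ.repMem_wf _) (hr F).lastApp).1 hz
  let H : Fn (Itr hμ.ultrafilter β) (rho hμ.ultrafilter β fun _ => ordSet κ) :=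
    ⟨_, rho_mem_itr hh.graph, hμ.isFunc_graph hh⟩
  exact ⟨H, (hμ.rho_lastApp_congr (hr H) hh.graph (hrF H)).trans (by rw [lastApp_graph])⟩

theorem IsMeasure.ult_eq (hμ : IsMeasure κ μ) (β : Ordinal.{u}) :
    Ult (Itr hμ.ultrafilter β) (rho hμ.ultrafilter β fun _ => ordSet κ)
      (rho hμ.ultrafilter β fun _ => μ) = Itr hμ.ultrafilter (β + 1) := by
  ext z
  constructor
  · rintro ⟨F, rfl⟩
    obtain ⟨f, hf, hF⟩ := F.2.1
    exact ⟨_, hf.lastApp, (hμ.ultClass_eq F hf hF).symm⟩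
  · rintro ⟨h, hh, rfl⟩
    refine ⟨⟨_, rho_mem_itr hh.graph, hμ.isFunc_graph hh⟩, ?_⟩
    exact (hμ.ultClass_eq _ hh.graph rfl).trans (by rw [lastApp_graph])

theorem IsMeasure.ultEmb_rho (hμ : IsMeasure κ μ) {f : (Ordinal.{u} → Pt κ) → ZFSet.{u}}
    (hf : FinDep β f) :
    ultEmb (Itr hμ.ultrafilter β) (rho hμ.ultrafilter β fun _ => ordSet κ)
      (rho hμ.ultrafilter β fun _ => μ) (rho hμ.ultrafilter β f) =
      rho hμ.ultrafilter (β + 1) f := by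
  have hf' : FinDep (β + 1) f := hf.mono (le_add_of_nonneg_right zero_le)
  have hup : ∀ s x, f (Function.update s β x) = f s := fun s x =>
    hf.dependsOn fun i hi => Function.update_of_ne (ne_of_lt hi) _ _
  -- the constant function is the graph of `f`, which ignores the last coordinate
  have hprod : ZFSet.prod (rho hμ.ultrafilter β fun _ => ordSet κ) {rho hμ.ultrafilter β f} =
      rho hμ.ultrafilter β (graph β f) := by
    ext z
    rw [hμ.mem_rho_graph_iff hf', ZFSet.mem_prod]
    simp only [hup]
    constructor
    · rintro ⟨a, ha, b, hb, rfl⟩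
      obtain ⟨x, hx, rfl⟩ := hμ.mem_rho_ordSet_iff.1 ha
      exact ⟨x, hx, by rw [ZFSet.mem_singleton.1 hb]⟩
    · rintro ⟨x, hx, rfl⟩
      exact ⟨_, hμ.mem_rho_ordSet_iff.2 ⟨x, hx, rfl⟩, _, ZFSet.mem_singleton.2 rfl, rfl⟩
  have h : ZFSet.prod (rho hμ.ultrafilter β fun _ => ordSet κ) {rho hμ.ultrafilter β f} ∈
      Itr hμ.ultrafilter β ∧ ∃ y, ZFSet.IsFunc (rho hμ.ultrafilter β fun _ => ordSet κ) y
        (ZFSet.prod (rho hμ.ultrafilter β fun _ => ordSet κ) {rho hμ.ultrafilter β f}) := by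
    rw [hprod]
    exact ⟨rho_mem_itr hf'.graph, hμ.isFunc_graph hf'⟩
  rw [ultEmb, dif_pos h]
  exact (hμ.ultClass_eq _ hf'.graph hprod.symm).trans (by rw [lastApp_graph])

end Succ

/-! ### The iterates -/

section Stage

variable {κ : Cardinal.{u}} {μ : ZFSet.{u}}

theorem rho_eq_rho_iff_of_le (hμ : IsMeasure κ μ) {γ β : Ordinal.{u}} (h : γ ≤ β)
    {f g : (Ordinal.{u} → Pt κ) → ZFSet.{u}} (hf : FinDep γ f) (hg : FinDep γ g) :
    rho hμ.ultrafilter β f = rho hμ.ultrafilter β g ↔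
      rho hμ.ultrafilter γ f = rho hμ.ultrafilter γ g := by
  rw [rho_eq_iff (hμ.repMem_wf β) (hf.mono h) (hg.mono h), rho_eq_iff (hμ.repMem_wf γ) hf hg,
    eventually_prodFilter_of_le h (hf.comp₂ hg fun x y => x = y).dependsOn]

theorem rho_mem_rho_iff_of_le (hμ : IsMeasure κ μ) {γ β : Ordinal.{u}} (h : γ ≤ β)
    {f g : (Ordinal.{u} → Pt κ) → ZFSet.{u}} (hf : FinDep γ f) (hg : FinDep γ g) :
    rho hμ.ultrafilter β f ∈ rho hμ.ultrafilter β g ↔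
      rho hμ.ultrafilter γ f ∈ rho hμ.ultrafilter γ g := by
  rw [rho_mem_iff (hμ.repMem_wf β) (hf.mono h) (hg.mono h), rho_mem_iff (hμ.repMem_wf γ) hf hg,
    eventually_prodFilter_of_le h (hf.comp₂ hg fun x y => x ∈ y).dependsOn]

/-- `S` is the `β`-th stage as described by functions of finitely many coordinates: these
represent its elements, and its embeddings leave the representing functions unchanged. -/
structure IsRepresented (hμ : IsMeasure κ μ) (β : Ordinal.{u}) (S : Stage.{u}) : Prop where
  carrier_eq : S.carrier = Itr hμ.ultrafilter β
  emb_eq : ∀ ξ ≤ β, ∀ f : (Ordinal.{u} → Pt κ) → ZFSet.{u}, FinDep ξ f →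
    S.emb ξ (rho hμ.ultrafilter ξ f) = rho hμ.ultrafilter β f

/-- With no coordinates available the representing functions are constant, and `M_0 = V`. -/
theorem rho_zero_const (hμ : IsMeasure κ μ) (x : ZFSet.{u}) :
    rho hμ.ultrafilter 0 (fun _ => x) = x := by
  have hwf := hμ.repMem_wf 0
  obtain ⟨k⟩ := hμ.nonempty_pt
  induction x using ZFSet.inductionOn with
  | _ x ih =>
  ext z
  rw [mem_rho_iff hwf (FinDep.const x)]
  constructor
  · rintro ⟨g, hg, hgx, rfl⟩
    have h1 : g = fun _ => g fun _ => k := funext fun s =>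
      hg.dependsOn fun i hi => absurd (Set.mem_Iio.1 hi) not_lt_zero
    have h2 := eventually_prodFilter_zero.1 hgx fun _ => k
    rw [h1, ih _ h2]
    exact h2
  · exact fun hz => ⟨fun _ => z, FinDep.const z, .of_forall fun _ => hz, ih z hz⟩

theorem IsRepresented.zero (hμ : IsMeasure κ μ) :
    IsRepresented hμ 0 { carrier := Set.univ, emb := fun _ x => x } where
  carrier_eq := by
    refine (Set.eq_univ_of_forall fun x => ?_).symm
    exact ⟨fun _ => x, FinDep.const x, rho_zero_const hμ x⟩
  emb_eq ξ hξ f _ := by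
    obtain rfl : ξ = 0 := le_antisymm hξ zero_le
    rfl

theorem IsRepresented.succ {hμ : IsMeasure κ μ} {β : Ordinal.{u}} {S : Stage.{u}}
    (hS : IsRepresented hμ β S) :
    IsRepresented hμ (β + 1) (succStage (ordSet κ) μ β S) := by
  have h0 : ∀ x, S.emb 0 x = rho hμ.ultrafilter β fun _ => x := fun x => by
    conv_lhs => rw [← rho_zero_const hμ x]
    exact hS.emb_eq 0 zero_le _ (FinDep.const x)
  constructor
  · change Ult S.carrier (S.emb 0 (ordSet κ)) (S.emb 0 μ) = _
    rw [h0, h0, hS.carrier_eq, hμ.ult_eq]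
  · intro ξ hξ f hf
    change (if ξ ≤ β then ultEmb S.carrier (S.emb 0 (ordSet κ)) (S.emb 0 μ)
      (S.emb ξ (rho hμ.ultrafilter ξ f)) else rho hμ.ultrafilter ξ f) = _
    by_cases h : ξ ≤ β
    · rw [if_pos h, h0, h0, hS.carrier_eq, hS.emb_eq ξ h f hf, hμ.ultEmb_rho (hf.mono h)]
    · rw [if_neg h, le_antisymm hξ (Order.add_one_le_of_lt (not_le.1 h))]

theorem IsRepresented.limit {hμ : IsMeasure κ μ} {l : Ordinal.{u}} (hl : Order.IsSuccLimit l)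
    {S : ∀ ξ < l, Stage.{u}} (hS : ∀ ξ h, IsRepresented hμ ξ (S ξ h)) :
    IsRepresented hμ l (limitStage l S) := by
  have hr : ∀ p : Thread l S, ∃ f : (Ordinal.{u} → Pt κ) → ZFSet.{u}, FinDep p.1.1 f ∧
      rho hμ.ultrafilter p.1.1 f = p.1.2 := by
    rintro ⟨⟨ξ, x⟩, hξ, hx⟩
    rwa [(hS ξ hξ).carrier_eq] at hx
  choose r hrd hrp using hr
  have hlt : ∀ p : Thread l S, p.1.1 < l := fun p => p.2.1
  -- the embeddings keep the representing function of a thread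
  have hemb : ∀ (p : Thread l S) (ζ : Ordinal.{u}) (h : ζ < l), p.1.1 ≤ ζ →
      (S ζ h).emb p.1.1 p.1.2 = rho hμ.ultrafilter ζ (r p) := fun p ζ h hp => by
    rw [← hrp p]
    exact (hS ζ h).emb_eq _ hp _ (hrd p)
  -- a function of finitely many coordinates below a limit depends on boundedly many
  have hbound : ∀ f : (Ordinal.{u} → Pt κ) → ZFSet.{u}, FinDep l f → ∃ ξ < l, FinDep ξ f := by
    rintro f ⟨a, ha, hfa⟩
    refine ⟨a.sup fun i => i + 1, ?_, a, fun i hi => ?_, hfa⟩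
    · rw [Finset.sup_lt_iff (bot_lt_iff_ne_bot.2 hl.ne_bot)]
      exact fun i hi => hl.add_one_lt (ha i hi)
    · exact (lt_add_one i).trans_le (Finset.le_sup (f := fun i => i + 1) hi)
  have hpt : ∀ ξ (h : ξ < l) (f : (Ordinal.{u} → Pt κ) → ZFSet.{u}) (hf : FinDep ξ f),
      ∃ h' : (∃ h : ξ < l, rho hμ.ultrafilter ξ f ∈ (S ξ h).carrier),
        rho hμ.ultrafilter l (r ⟨(ξ, rho hμ.ultrafilter ξ f), h'⟩) = rho hμ.ultrafilter l f := by
    intro ξ h f hf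
    have h' : ∃ h : ξ < l, rho hμ.ultrafilter ξ f ∈ (S ξ h).carrier :=
      ⟨h, by rw [(hS ξ h).carrier_eq]; exact rho_mem_itr hf⟩
    let p : Thread l S := ⟨(ξ, rho hμ.ultrafilter ξ f), h'⟩
    exact ⟨h', (rho_eq_rho_iff_of_le hμ h.le (hrd p) hf).2 (hrp p)⟩
  have hcol : ∀ p : Thread l S, quotCollapse threadEq threadMem p = rho hμ.ultrafilter l (r p) := by
    refine quotCollapse_eq _ (fun p q => ?_) (fun p q => ?_) fun p z hz => ?_
    · constructor
      · rintro ⟨ζ, h, hp, hq, heq⟩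
        rw [hemb p ζ h hp, hemb q ζ h hq] at heq
        exact (rho_eq_rho_iff_of_le hμ h.le ((hrd p).mono hp) ((hrd q).mono hq)).2 heq
      · intro heq
        have h := max_lt (hlt p) (hlt q)
        refine ⟨_, h, le_max_left _ _, le_max_right _ _, ?_⟩
        rw [hemb p _ h (le_max_left _ _), hemb q _ h (le_max_right _ _)]
        exact (rho_eq_rho_iff_of_le hμ h.le ((hrd p).mono (le_max_left _ _))
          ((hrd q).mono (le_max_right _ _))).1 heq
    · constructor
      · rintro ⟨ζ, h, hp, hq, heq⟩
        rw [hemb p ζ h hp, hemb q ζ h hq] at heq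
        exact (rho_mem_rho_iff_of_le hμ h.le ((hrd p).mono hp) ((hrd q).mono hq)).2 heq
      · intro heq
        have h := max_lt (hlt p) (hlt q)
        refine ⟨_, h, le_max_left _ _, le_max_right _ _, ?_⟩
        rw [hemb p _ h (le_max_left _ _), hemb q _ h (le_max_right _ _)]
        exact (rho_mem_rho_iff_of_le hμ h.le ((hrd p).mono (le_max_left _ _))
          ((hrd q).mono (le_max_right _ _))).1 heq
    · obtain ⟨f, hf, -, rfl⟩ := (mem_rho_iff (hμ.repMem_wf l) ((hrd p).mono (hlt p).le)).1 hz
      obtain ⟨ξ, hξ, hfξ⟩ := hbound f hf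
      obtain ⟨h', heq⟩ := hpt ξ hξ f hfξ
      exact ⟨_, heq⟩
  constructor
  · ext z
    constructor
    · rintro ⟨p, rfl⟩
      exact ⟨r p, (hrd p).mono (hlt p).le, (hcol p).symm⟩
    · rintro ⟨f, hf, rfl⟩
      obtain ⟨ξ, hξ, hfξ⟩ := hbound f hf
      obtain ⟨h', heq⟩ := hpt ξ hξ f hfξ
      exact ⟨_, (hcol _).trans heq⟩
  · intro ξ hξ f hf
    rcases hξ.lt_or_eq with h | rfl
    · obtain ⟨h', heq⟩ := hpt ξ h f hf
      simp only [limitStage]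
      rw [if_pos h, dif_pos h']
      exact (hcol _).trans heq
    · simp only [limitStage]
      rw [if_neg (lt_irrefl _)]

theorem IsMeasure.isRepresented_stage (hμ : IsMeasure κ μ) (β : Ordinal.{u}) :
    IsRepresented hμ β (stage (ordSet κ) μ β) := by
  induction β using Ordinal.limitRecOn with
  | zero =>
    rw [stage, Ordinal.limitRecOn_zero]
    exact .zero hμ
  | add_one β ih =>
    rw [stage, Ordinal.limitRecOn_add_one]
    exact ih.succ
  | limit l hl ih =>
    rw [stage, Ordinal.limitRecOn_limit _ _ _ _ hl]
    exact .limit hl ih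

theorem IsMeasure.iterate_eq (hμ : IsMeasure κ μ) (β : Ordinal.{u}) :
    Iterate κ μ β = Itr hμ.ultrafilter β :=
  (hμ.isRepresented_stage β).carrier_eq

end Stage

/-! ### Cofinal maps between von Neumann ordinals -/

section Cofinal

/-- The von Neumann ordinal corresponding to an element of the order type `α.ToType`. -/
noncomputable def tz {α : Ordinal.{u}} (j : α.ToType) : ZFSet.{u} :=
  (Ordinal.ToType.mk.symm j).1.toZFSet

variable {α γ δ : Ordinal.{u}}

theorem mem_toZFSet_iff_tz {x : ZFSet.{u}} : x ∈ α.toZFSet ↔ ∃ j : α.ToType, tz j = x := by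
  rw [Ordinal.mem_toZFSet_iff]
  constructor
  · rintro ⟨o, ho, rfl⟩
    exact ⟨Ordinal.ToType.mk ⟨o, ho⟩, by simp [tz]⟩
  · rintro ⟨j, rfl⟩
    exact ⟨_, (Ordinal.ToType.mk.symm j).2, rfl⟩

theorem tz_mem (j : α.ToType) : tz j ∈ α.toZFSet := mem_toZFSet_iff_tz.2 ⟨j, rfl⟩

theorem tz_injective : Function.Injective (tz : α.ToType → ZFSet.{u}) := fun i j h => by
  have := Ordinal.toZFSet_injective h
  exact Ordinal.ToType.mk.symm.injective (Subtype.ext this)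

theorem tz_mem_tz {i j : α.ToType} : tz i ∈ tz j ↔ i < j := by
  rw [tz, tz, Ordinal.toZFSet_mem_toZFSet_iff, Subtype.coe_lt_coe, OrderIso.lt_iff_lt]

theorem eq_or_mem_tz {i j : α.ToType} : (tz i = tz j ∨ tz i ∈ tz j) ↔ i ≤ j := by
  rw [tz_injective.eq_iff, tz_mem_tz, le_iff_eq_or_lt]

theorem IsCofinalMap.exists_map {f : ZFSet.{u}} (hf : IsCofinalMap f γ.toZFSet α.toZFSet) :
    ∃ φ : γ.ToType → α.ToType, (∀ p, p ∈ f ↔ ∃ i, p = ZFSet.pair (tz i) (tz (φ i))) ∧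
      IsCofinal (Set.range φ) := by
  obtain ⟨⟨hsub, hfun⟩, hcof⟩ := hf
  have h1 : ∀ i : γ.ToType, ∃ j : α.ToType, ZFSet.pair (tz i) (tz j) ∈ f := fun i => by
    obtain ⟨w, hw, -⟩ := hfun _ (tz_mem i)
    obtain ⟨j, rfl⟩ := mem_toZFSet_iff_tz.1 (ZFSet.pair_mem_prod.1 (hsub hw)).2
    exact ⟨j, hw⟩
  choose φ hφ using h1
  have h2 : ∀ p, p ∈ f ↔ ∃ i, p = ZFSet.pair (tz i) (tz (φ i)) := fun p => by
    constructor
    · intro hp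
      obtain ⟨a, ha, b, hb, rfl⟩ := ZFSet.mem_prod.1 (hsub hp)
      obtain ⟨i, rfl⟩ := mem_toZFSet_iff_tz.1 ha
      exact ⟨i, by rw [(hfun _ ha).unique hp (hφ i)]⟩
    · rintro ⟨i, rfl⟩
      exact hφ i
  refine ⟨φ, h2, fun j => ?_⟩
  obtain ⟨y, hy, z, hz, hyz, hle⟩ := hcof _ (tz_mem j)
  obtain ⟨i, hi⟩ := (h2 _).1 hyz
  obtain ⟨rfl, rfl⟩ := ZFSet.pair_inj.1 hi
  exact ⟨φ i, ⟨i, rfl⟩, eq_or_mem_tz.1 hle⟩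

theorem IsCofinalMap.of_map {f : ZFSet.{u}} (φ : γ.ToType → α.ToType)
    (hf : ∀ p, p ∈ f ↔ ∃ i, p = ZFSet.pair (tz i) (tz (φ i))) (hφ : IsCofinal (Set.range φ)) :
    IsCofinalMap f γ.toZFSet α.toZFSet := by
  refine ⟨⟨fun p hp => ?_, fun z hz => ?_⟩, fun x hx => ?_⟩
  · obtain ⟨i, rfl⟩ := (hf p).1 hp
    exact ZFSet.pair_mem_prod.2 ⟨tz_mem i, tz_mem _⟩
  · obtain ⟨i, rfl⟩ := mem_toZFSet_iff_tz.1 hz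
    refine ⟨tz (φ i), (hf _).2 ⟨i, rfl⟩, fun w hw => ?_⟩
    obtain ⟨i', h⟩ := (hf _).1 hw
    obtain ⟨h1, rfl⟩ := ZFSet.pair_inj.1 h
    rw [tz_injective h1]
  · obtain ⟨j, rfl⟩ := mem_toZFSet_iff_tz.1 hx
    obtain ⟨_, ⟨i, rfl⟩, hle⟩ := hφ j
    exact ⟨_, tz_mem i, _, tz_mem (φ i), (hf _).2 ⟨i, rfl⟩, eq_or_mem_tz.2 hle⟩

theorem IsCofinalMap.cof_le {f : ZFSet.{u}} (hf : IsCofinalMap f γ.toZFSet α.toZFSet) :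
    α.cof ≤ γ.card := by
  obtain ⟨φ, -, hφ⟩ := hf.exists_map
  rw [← Ordinal.cof_toType, ← Cardinal.mk_toType γ]
  exact (Order.cof_le hφ).trans Cardinal.mk_range_le

/-- The restriction of a relation `f`, coded as a set of pairs, to `c`. -/
noncomputable def restr (f c : ZFSet.{u}) : ZFSet.{u} :=
  f.sep fun p => ∃ y ∈ c, ∃ z, p = ZFSet.pair y z

theorem mem_restr {f c p : ZFSet.{u}} :
    p ∈ restr f c ↔ p ∈ f ∧ ∃ y ∈ c, ∃ z, p = ZFSet.pair y z :=
  ZFSet.mem_sep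

end Cofinal

/-! ### Ordinals and restrictions in the iterates -/

section Itr

variable {κ : Cardinal.{u}} {μ : ZFSet.{u}} {β : Ordinal.{u}}

theorem restr_mem_itr {K : Type (u + 1)} [Small.{u} K] {U : Ultrafilter K}
    (hwf : WellFounded (RepMem U β)) {f c : ZFSet.{u}} (hf : f ∈ Itr U β) (hc : c ∈ Itr U β) :
    restr f c ∈ Itr U β := by
  obtain ⟨f, hf, rfl⟩ := hf
  obtain ⟨c, hc, rfl⟩ := hc
  refine ⟨fun s => restr (f s) (c s), hf.comp₂ hc restr, ?_⟩
  ext p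
  rw [mem_restr, mem_rho_iff hwf (hf.comp₂ hc restr)]
  constructor
  · rintro ⟨e, he, h1, rfl⟩
    refine ⟨(rho_mem_iff hwf he hf).2 (h1.mono fun s hs => (mem_restr.1 hs).1), ?_⟩
    obtain ⟨y, hy, h2⟩ := (he.comp₂ hc Prod.mk).exists_of_eventually
      (Q := fun t y => y ∈ t.2 ∧ ∃ z, t.1 = ZFSet.pair y z)
      (h1.mono fun s hs => (mem_restr.1 hs).2)
    obtain ⟨z, hz, h3⟩ := (he.comp₂ hy Prod.mk).exists_of_eventually
      (Q := fun t z => t.1 = ZFSet.pair t.2 z) (h2.mono fun s hs => hs.2)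
    refine ⟨_, (rho_mem_iff hwf hy hc).2 (h2.mono fun s hs => hs.1), rho U β z, ?_⟩
    rw [← rho_pair hwf hy hz]
    exact rho_congr hwf he (hy.comp₂ hz ZFSet.pair) h3
  · rintro ⟨h1, y, hy, z, rfl⟩
    obtain ⟨⟨y, hyd, rfl⟩, ⟨z, hzd, rfl⟩⟩ := mem_itr_of_pair hwf (rho_mem_itr hf) h1
    rw [pair_rho_mem_iff hwf hyd hzd hf] at h1
    rw [rho_mem_iff hwf hyd hc] at hy
    refine ⟨_, hyd.comp₂ hzd ZFSet.pair, ?_, rho_pair hwf hyd hzd⟩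
    filter_upwards [h1, hy] with s h2 h3
    exact mem_restr.2 ⟨h2, _, h3, _, rfl⟩

theorem isOrdinal_rho_const {K : Type (u + 1)} [Small.{u} K] {U : Ultrafilter K}
    (hwf : WellFounded (RepMem U β)) (α : Ordinal.{u}) :
    (rho U β fun _ => α.toZFSet).IsOrdinal := by
  have hα := ZFSet.isOrdinal_toZFSet α
  refine ⟨fun y hy z hz => ?_, fun {x y z} hxy hyz hz => ?_⟩
  · obtain ⟨g, hg, h1, rfl⟩ := (mem_rho_iff hwf (FinDep.const _)).1 hy
    obtain ⟨k, hk, h2, rfl⟩ := (mem_rho_iff hwf hg).1 hz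
    rw [rho_mem_iff hwf hk (FinDep.const _)]
    filter_upwards [h1, h2] with s h3 h4
    exact hα.subset_of_mem h3 h4
  · obtain ⟨g, hg, h1, rfl⟩ := (mem_rho_iff hwf (FinDep.const _)).1 hz
    obtain ⟨k, hk, h2, rfl⟩ := (mem_rho_iff hwf hg).1 hyz
    obtain ⟨l, hl, h3, rfl⟩ := (mem_rho_iff hwf hk).1 hxy
    rw [rho_mem_iff hwf hl hg]
    filter_upwards [h1, h2, h3] with s h4 h5 h6
    exact hα.mem_trans' h6 h5 h4

/-- Every ordinal belongs to the iterate: `j(α)` is an ordinal which is at least `α`, and the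
iterate is transitive. -/
theorem toZFSet_mem_itr {K : Type (u + 1)} [Small.{u} K] {U : Ultrafilter K}
    (hwf : WellFounded (RepMem U β)) (α : Ordinal.{u}) : α.toZFSet ∈ Itr U β := by
  have hmono : StrictMono fun α : Ordinal.{u} => (rho U β fun _ => α.toZFSet).rank :=
    fun a b hab => ZFSet.rank_lt_of_mem <| (rho_mem_iff hwf (FinDep.const _) (FinDep.const _)).2 <|
      .of_forall fun _ => Ordinal.toZFSet_mem_toZFSet_iff.2 hab
  have hle : α ≤ (rho U β fun _ => α.toZFSet).rank := hmono.le_apply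
  have hmem : (rho U β fun _ => α.toZFSet).rank.toZFSet ∈ Itr U β := by
    rw [(isOrdinal_rho_const hwf α).toZFSet_rank_eq]
    exact rho_mem_itr (FinDep.const _)
  rcases hle.eq_or_lt with heq | hlt
  · rwa [← heq] at hmem
  · exact itr_transitive hwf hmem (Ordinal.toZFSet_mem_toZFSet_iff.2 hlt)

/-- The embeddings do not move the ordinals below `κ`, by `κ`-completeness. -/
theorem IsMeasure.rho_const_of_lt (hμ : IsMeasure κ μ) {ξ : Ordinal.{u}} (hξ : ξ < κ.ord) :
    rho hμ.ultrafilter β (fun _ => ξ.toZFSet) = ξ.toZFSet := by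
  have hwf := hμ.repMem_wf β
  induction ξ using Ordinal.lt_wf.induction with
  | _ ξ ih =>
  ext z
  rw [mem_rho_iff hwf (FinDep.const _), Ordinal.mem_toZFSet_iff]
  constructor
  · rintro ⟨g, hg, h1, rfl⟩
    have h2 : ∃ i : ξ.ToType, ∀ᶠ s in prodFilter hμ.ultrafilter β, g s = tz i := by
      by_contra hne
      have h3 := hμ.ltComplete.prodFilter β ξ.ToType (fun i s => ¬ g s = tz i)
        (by rw [Cardinal.mk_toType]; exact Cardinal.lt_ord.1 hξ)
        fun i => ((hg.comp fun x => x = tz i).eventually_not).1 fun h => hne ⟨i, h⟩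
      obtain ⟨s, h4, h5⟩ := (h1.and h3).exists
      obtain ⟨i, hi⟩ := mem_toZFSet_iff_tz.1 h4
      exact h5 i hi.symm
    obtain ⟨i, hi⟩ := h2
    have h3 := (Ordinal.ToType.mk.symm i).2
    exact ⟨_, h3, ((rho_congr hwf hg (FinDep.const _) hi).trans
      (ih _ h3 (lt_trans h3 hξ))).symm⟩
  · rintro ⟨η, hη, rfl⟩
    exact ⟨_, FinDep.const _, .of_forall fun _ => Ordinal.toZFSet_mem_toZFSet_iff.2 hη,
      ih η hη (hη.trans hξ)⟩

/-- Fewer than `κ` finite sets of coordinates are available, so, if `cf(α) = κ`, then cofinally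
many elements of `α` are represented by functions of the same coordinates. -/
theorem IsMeasure.exists_common_support (hμ : IsMeasure κ μ) (hβ : β < κ.ord) {α : Ordinal.{u}}
    (hα : α.cof = κ) :
    ∃ a : Finset Ordinal.{u}, (∀ i ∈ a, i < β) ∧
      ∃ C : Set α.ToType, IsCofinal C ∧ Cardinal.mk C ≤ κ ∧
        ∀ c ∈ C, ∃ f : (Ordinal.{u} → Pt κ) → ZFSet.{u}, DependsOn f (a : Set Ordinal.{u}) ∧
          rho hμ.ultrafilter β f = tz c := by
  obtain ⟨C, hC, hCcard⟩ := Order.exists_cof_eq α.ToType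
  rw [Ordinal.cof_toType, hα] at hCcard
  let emb : β.ToType ↪ Ordinal.{u} :=
    ⟨fun i => (Ordinal.ToType.mk.symm i).1,
      fun i j h => Ordinal.ToType.mk.symm.injective (Subtype.ext h)⟩
  let D : Finset β.ToType → Set α.ToType := fun a =>
    {c ∈ C | ∃ f : (Ordinal.{u} → Pt κ) → ZFSet.{u},
      DependsOn f ((a.map emb : Finset Ordinal.{u}) : Set Ordinal.{u}) ∧
        rho hμ.ultrafilter β f = tz c}
  have hD : ⋃ a, D a = C := by
    refine Set.Subset.antisymm (Set.iUnion_subset fun a c hc => hc.1) fun c hc => ?_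
    obtain ⟨f, ⟨a, ha, hfa⟩, hfc⟩ := itr_transitive (hμ.repMem_wf β)
      (toZFSet_mem_itr (hμ.repMem_wf β) α) (tz_mem c)
    classical
    have hrange : ∀ i ∈ a, ∃ j, emb j = i := fun i hi =>
      ⟨Ordinal.ToType.mk ⟨i, ha i hi⟩, congrArg Subtype.val (OrderIso.symm_apply_apply _ _)⟩
    refine Set.mem_iUnion.2 ⟨a.preimage emb emb.injective.injOn, hc, f,
      hfa.mono fun i hi => ?_, hfc⟩
    obtain ⟨j, rfl⟩ := hrange i hi
    exact Finset.mem_map_of_mem _ (Finset.mem_preimage.2 hi)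
  have hcard : Cardinal.mk (Finset β.ToType) < κ := by
    have hβ' : Cardinal.mk β.ToType < κ := by
      rw [Cardinal.mk_toType]
      exact Cardinal.lt_ord.1 hβ
    rcases finite_or_infinite β.ToType with hfin | hinf
    · exact (Cardinal.lt_aleph0_of_finite _).trans hμ.uncountable
    · rwa [Cardinal.mk_finset_of_infinite]
  obtain ⟨a, ha⟩ := isCofinal_of_isCofinal_iUnion (s := D) (by rwa [hD])
    (by rwa [Ordinal.cof_toType, hα])
  refine ⟨a.map emb, fun i hi => ?_, D a, ha, ?_, fun c hc => hc.2⟩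
  · obtain ⟨j, -, rfl⟩ := Finset.mem_map.1 hi
    exact (Ordinal.ToType.mk.symm j).2
  · exact hCcard ▸ Cardinal.mk_le_mk_of_subset fun c hc => hc.1

/-- A sequence of length `κ` of elements of the iterate whose representing functions depend on the
same finitely many coordinates belongs to the iterate: it is the restriction to `κ` of the
element represented by the sequence of representing functions. -/
theorem IsMeasure.seq_mem_itr (hμ : IsMeasure κ μ) {a : Finset Ordinal.{u}} (ha : ∀ i ∈ a, i < β)
    (f : κ.ord.ToType → (Ordinal.{u} → Pt κ) → ZFSet.{u})
    (hf : ∀ i, DependsOn (f i) (a : Set Ordinal.{u})) :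
    (ZFSet.range fun i => ZFSet.pair (tz i) (rho hμ.ultrafilter β (f i))) ∈
      Itr hμ.ultrafilter β := by
  have hwf := hμ.repMem_wf β
  have hfd : ∀ i, FinDep β (f i) := fun i => ⟨a, ha, hf i⟩
  let F : (Ordinal.{u} → Pt κ) → ZFSet.{u} := fun s =>
    ZFSet.range fun i => ZFSet.pair (tz i) (f i s)
  have hF : FinDep β F := ⟨a, ha, fun s t hst => by simp only [F, fun i => hf i hst]⟩
  have htz : ∀ i : κ.ord.ToType, rho hμ.ultrafilter β (fun _ => tz i) = tz i := fun i =>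
    hμ.rho_const_of_lt (Ordinal.ToType.mk.symm i).2
  convert restr_mem_itr hwf (rho_mem_itr hF) (toZFSet_mem_itr hwf κ.ord)
  ext p
  rw [ZFSet.mem_range, mem_restr]
  constructor
  · rintro ⟨i, rfl⟩
    refine ⟨?_, _, tz_mem i, _, rfl⟩
    have h := (pair_rho_mem_iff hwf (FinDep.const (tz i)) (hfd i) hF).2
      (.of_forall fun s => ZFSet.mem_range.2 ⟨i, rfl⟩)
    rwa [htz] at h
  · rintro ⟨h1, y, hy, z, rfl⟩
    obtain ⟨i, rfl⟩ := mem_toZFSet_iff_tz.1 hy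
    obtain ⟨z, hz, rfl⟩ := (mem_itr_of_pair hwf (rho_mem_itr hF) h1).2
    rw [← htz i, pair_rho_mem_iff hwf (FinDep.const _) hz hF] at h1
    refine ⟨i, ?_⟩
    congr 1
    refine rho_congr hwf (hfd i) hz (h1.mono fun s hs => ?_)
    obtain ⟨i', h2⟩ := ZFSet.mem_range.1 hs
    obtain ⟨h3, h4⟩ := ZFSet.pair_inj.1 h2
    rw [← h4, tz_injective h3]

/-- A cofinal map from `κ` to `α` in `V` can be replaced by one in the iterate. -/
theorem IsMeasure.exists_isCofinalMap (hμ : IsMeasure κ μ) (hβ : β < κ.ord) {α : Ordinal.{u}}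
    (hα : α.cof = κ) :
    ∃ f ∈ Itr hμ.ultrafilter β, IsCofinalMap f κ.ord.toZFSet α.toZFSet := by
  obtain ⟨a, ha, C, hC, hCcard, hf⟩ := hμ.exists_common_support hβ hα
  have hne : Nonempty C := by
    by_contra hemp
    have h0 : Cardinal.mk C = 0 := Cardinal.mk_eq_zero_iff.2 (not_nonempty_iff.1 hemp)
    have h1 := Order.cof_le hC
    rw [Ordinal.cof_toType, hα, h0] at h1
    exact absurd (hμ.uncountable.trans_le h1) (by simp)
  obtain ⟨e, he⟩ : ∃ e : κ.ord.ToType → C, Function.Surjective e := by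
    rw [← Cardinal.mk_ord_toType κ, Cardinal.le_def] at hCcard
    obtain ⟨i⟩ := hCcard
    exact ⟨Function.invFun i, Function.invFun_surjective i.injective⟩
  choose f hfa hfc using fun i => hf (e i).1 (e i).2
  refine ⟨_, hμ.seq_mem_itr ha f hfa, .of_map (fun i => (e i).1) (fun p => ?_) ?_⟩
  · simp only [ZFSet.mem_range, hfc, eq_comm]
  · convert hC
    ext c
    exact ⟨fun ⟨i, hi⟩ => hi ▸ (e i).2, fun hc =>
      (he ⟨c, hc⟩).imp fun i hi => congrArg Subtype.val hi⟩

/-- In the iterate `κ` is not the least length of a cofinal sequence in `α` if `cf(α) < κ`: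
by regularity of `κ`, an initial segment of each cofinal sequence of length `κ` is cofinal. -/
theorem IsMeasure.le_cof_of_satCofEq (hμ : IsMeasure κ μ) {α : Ordinal.{u}}
    (h : SatCofEq (Itr hμ.ultrafilter β) α.toZFSet κ.ord.toZFSet) : κ ≤ α.cof := by
  have hwf := hμ.repMem_wf β
  obtain ⟨-, -, ⟨f, hfM, hf⟩, hmin⟩ := h
  by_contra! hlt
  obtain ⟨φ, hφ, hcof⟩ := hf.exists_map
  obtain ⟨C, hC, hCcard⟩ := Order.exists_cof_eq α.ToType
  rw [Ordinal.cof_toType] at hCcard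
  have hi : ∀ c : C, ∃ i, c.1 ≤ φ i := fun c => by
    obtain ⟨_, ⟨i, rfl⟩, h⟩ := hcof c.1
    exact ⟨i, h⟩
  choose i hi using hi
  let o : C → Ordinal.{u} := fun c => (Ordinal.ToType.mk.symm (i c)).1
  have hδ : ⨆ c, o c + 1 < κ.ord :=
    Ordinal.iSup_add_one_lt_of_lt_cof (by rwa [hμ.isRegular.cof_ord, hCcard])
      fun c => (Ordinal.ToType.mk.symm (i c)).2
  set δ := ⨆ c, o c + 1
  have hoδ : ∀ c, o c < δ := fun c =>
    (lt_add_one _).trans_le (Ordinal.le_iSup (fun c => o c + 1) c)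
  let incl : δ.ToType → κ.ord.ToType := fun j =>
    Ordinal.ToType.mk ⟨(Ordinal.ToType.mk.symm j).1,
      Set.mem_Iio.2 (lt_trans (Set.mem_Iio.1 (Ordinal.ToType.mk.symm j).2) hδ)⟩
  have hincl : ∀ j, tz (incl j) = tz j := fun j => by simp [tz, incl]
  refine hmin δ.toZFSet (Ordinal.toZFSet_mem_toZFSet_iff.2 hδ)
    ⟨restr f δ.toZFSet, restr_mem_itr hwf hfM (toZFSet_mem_itr hwf δ),
      .of_map (fun j => φ (incl j)) (fun p => ?_) fun x => ?_⟩
  · rw [mem_restr, hφ]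
    constructor
    · rintro ⟨⟨k, rfl⟩, y, hy, z, hyz⟩
      obtain ⟨j, rfl⟩ := mem_toZFSet_iff_tz.1 hy
      have h1 : k = incl j := tz_injective ((ZFSet.pair_inj.1 hyz).1.trans (hincl j).symm)
      exact ⟨j, by rw [h1, hincl]⟩
    · rintro ⟨j, rfl⟩
      exact ⟨⟨incl j, by rw [hincl]⟩, _, tz_mem j, _, rfl⟩
  · obtain ⟨c, hc, hxc⟩ := hC x
    refine ⟨_, ⟨Ordinal.ToType.mk ⟨o ⟨c, hc⟩, hoδ _⟩, rfl⟩, hxc.trans ?_⟩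
    have h1 : incl (Ordinal.ToType.mk ⟨o ⟨c, hc⟩, hoδ _⟩) = i ⟨c, hc⟩ := by simp [incl, o]
    beta_reduce
    rw [h1]
    exact hi ⟨c, hc⟩

end Itr

end IterUlt

theorem mainTheorem8 (κ : Cardinal.{u}) (μ : ZFSet.{u}) (hμ : IterUlt.IsMeasure κ μ)
    (β : Ordinal.{u}) (hβ : β < κ.ord) (α : Ordinal.{u}) :
    IterUlt.SatCofEq (IterUlt.Iterate κ μ β) α.toZFSet κ.ord.toZFSet ↔ α.cof = κ := by
  have hwf := hμ.repMem_wf β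
  rw [hμ.iterate_eq]
  constructor
  · intro h
    obtain ⟨f, -, hf⟩ := h.2.2.1
    exact le_antisymm (hf.cof_le.trans_eq (Cardinal.card_ord κ)) (hμ.le_cof_of_satCofEq h)
  · intro h
    refine ⟨IterUlt.toZFSet_mem_itr hwf α, IterUlt.toZFSet_mem_itr hwf κ.ord,
      hμ.exists_isCofinalMap hβ h, ?_⟩
    rintro _ hγ ⟨f, -, hf⟩
    obtain ⟨γ, hγκ, rfl⟩ := Ordinal.mem_toZFSet_iff.1 hγ
    exact (h ▸ hf.cof_le).not_gt (Cardinal.lt_ord.1 hγκ)
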